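/- Let $K$ be an algebraically closed field, let $Q$ be a finite connected quiver which is biserial (at each vertex at most two arrows start and at most two arrows end), and let $I$ be an admissible ideal of the path algebra $KQ$, i.e. $R^m\subseteq I\subseteq R^2$ for some $m\ge 2$, where $R$ is the ideal generated by the arrows. Assume that the algebra $\Lambda=KQ/I$ is tame, symmetric, and periodic of period four, i.e. $4$ is the smallest integer $d\ge 1$ with $\Omega^d_{\Lambda^e}(\Lambda)\cong\Lambda$ as $\Lambda$-bimodules. Paths are composed from left to right. For a path $p$ write $p\prec I$ if $p$ occurs with non-zero coefficient in some minimal relation of $I$, i.e. in some element of $e_aIe_b\setminus(RI+IR)$ with $a,b$ vertices. A vertex $i$ is regular if the number of arrows ending at $i$ equals the number of arrows starting at $i$ and this number is $1$ or $2$; otherwise it is non-regular. A $(1,2)$-vertex is a vertex at which exactly one arrow $\alpha$ ends and exactly two arrows $\beta,\bar\beta$ start; it is of type R if $\alpha\beta\prec I$ and $\alpha\bar\beta\prec I$, and proper if $\beta$ and $\bar\beta$ have distinct targets. Dually, a $(2,1)$-vertex is a vertex at which exactly two arrows $\alpha,\alpha^*$ end and exactly one arrow $\beta$ starts; it is of type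 R if $\alpha\beta\prec I$ and $\alpha^*\beta\prec I$, and proper if $\alpha$ and $\alpha^*$ have distinct sources. Then $Q$ has no proper non-regular vertex of type R; that is, no $(1,2)$-vertex and no $(2,1)$-vertex of $Q$ is both proper and of type R. -/

import Mathlib

open Quiver TensorProduct

universe u v w

/-! ### The path algebra of a finite quiver -/

/-- The type of all paths (of any length, including the trivial ones) of a quiver. -/
abbrev Quiver.AnyPath (V : Type v) [Quiver.{w} V] : Type (max v w) :=
  Σ a b : V, Quiver.Path a b

/-- The path algebra `KQ`: the vector space with basis all paths of `Q`. -/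
def PathAlgebra (K : Type u) (V : Type v) [Field K] [Quiver.{w} V] : Type (max u v w) :=
  Quiver.AnyPath V →₀ K

noncomputable section

namespace PathAlgebra

variable {K : Type u} {V : Type v} [Field K] [Quiver.{w} V]

instance : AddCommGroup (PathAlgebra K V) :=
  inferInstanceAs (AddCommGroup (Quiver.AnyPath V →₀ K))

instance : Module K (PathAlgebra K V) :=
  inferInstanceAs (Module K (Quiver.AnyPath V →₀ K))

/-- The coefficient of a path in an element of the path algebra. -/
def coeff (x : PathAlgebra K V) (p : Quiver.AnyPath V) : K :=
  (show Quiver.AnyPath V →₀ K from x) p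

/-- A path as an element of the path algebra. -/
def ofPath (K : Type u) {V : Type v} [Field K] [Quiver.{w} V] {a b : V} (p : Quiver.Path a b) :
    PathAlgebra K V :=
  (Finsupp.single ⟨a, b, p⟩ 1 : Quiver.AnyPath V →₀ K)

open Classical in
/-- The product of two paths: their concatenation (first `p`, then `q`) if the target of `p` is the
source of `q`, and zero otherwise. -/
def pathMul (K : Type u) {V : Type v} [Field K] [Quiver.{w} V] (p q : Quiver.AnyPath V) :
    PathAlgebra K V :=
  if h : p.2.1 = q.1 then ofPath K ((p.2.2.cast rfl h).comp q.2.2) else 0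

/-- The bilinear extension of the product of paths. -/
def mulHom (K : Type u) (V : Type v) [Field K] [Quiver.{w} V] :
    PathAlgebra K V →ₗ[K] PathAlgebra K V →ₗ[K] PathAlgebra K V :=
  Finsupp.linearCombination K (M := PathAlgebra K V →ₗ[K] PathAlgebra K V)
    (fun p : Quiver.AnyPath V =>
      (Finsupp.linearCombination K (M := PathAlgebra K V) (pathMul K p)))

theorem mulHom_ofPath {a b c d : V} (p : Quiver.Path a b) (q : Quiver.Path c d) :
    mulHom K V (ofPath K p) (ofPath K q) = pathMul K ⟨a, b, p⟩ ⟨c, d, q⟩ := by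
  have h1 : mulHom K V (ofPath K p) =
      Finsupp.linearCombination K (M := PathAlgebra K V) (pathMul K ⟨a, b, p⟩) :=
    (Finsupp.linearCombination_single K 1 _).trans (one_smul K _)
  rw [h1]
  exact (Finsupp.linearCombination_single K 1 _).trans (one_smul K _)

theorem mulHom_comp {a b c : V} (p : Quiver.Path a b) (q : Quiver.Path b c) :
    mulHom K V (ofPath K p) (ofPath K q) = ofPath K (p.comp q) := by
  rw [mulHom_ofPath, pathMul, dif_pos rfl]; rfl

theorem mulHom_ne {a b c d : V} (p : Quiver.Path a b) (q : Quiver.Path c d) (h : b ≠ c) :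
    mulHom K V (ofPath K p) (ofPath K q) = 0 := by
  rw [mulHom_ofPath, pathMul, dif_neg h]

theorem induction_on {motive : PathAlgebra K V → Prop} (x : PathAlgebra K V)
    (zero : motive 0) (add : ∀ x y, motive x → motive y → motive (x + y))
    (smul : ∀ (k : K) {a b : V} (p : Quiver.Path a b), motive (k • ofPath K p)) : motive x := by
  refine Finsupp.induction_linear (motive := motive) x zero (fun f g hf hg => add f g hf hg) ?_
  rintro ⟨a, b, p⟩ k
  have := smul k p
  have e : (k • ofPath K p : PathAlgebra K V) =
      (Finsupp.single ⟨a, b, p⟩ k : Quiver.AnyPath V →₀ K) :=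
    (Finsupp.smul_single k _ (1 : K)).trans (by rw [smul_eq_mul, mul_one])
  rwa [e] at this

theorem mulHom_assoc (x y z : PathAlgebra K V) :
    mulHom K V (mulHom K V x y) z = mulHom K V x (mulHom K V y z) := by
  induction x using induction_on with
  | zero => simp
  | add x x' hx hx' => simp only [map_add, LinearMap.add_apply, hx, hx']
  | smul k p =>
    induction y using induction_on with
    | zero => simp
    | add y y' hy hy' => simp only [map_add, LinearMap.add_apply, hy, hy']
    | smul l q =>
      induction z using induction_on with
      | zero => simp
      | add z z' hz hz' => simp only [map_add, hz, hz']
      | smul m r =>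
        rename_i a b c d e f
        simp only [map_smul, LinearMap.smul_apply]
        congr 3
        by_cases h : b = c
        · subst h
          by_cases h' : d = e
          · subst h'
            simp only [mulHom_comp, Quiver.Path.comp_assoc]
          · simp only [mulHom_comp, mulHom_ne _ _ h', map_zero]
        · by_cases h' : d = e
          · subst h'
            simp only [mulHom_comp, mulHom_ne _ _ h, map_zero, LinearMap.zero_apply]
          · simp only [mulHom_ne _ _ h, mulHom_ne _ _ h', map_zero, LinearMap.zero_apply]

/-- The trivial path at a vertex `a`, as an idempotent of the path algebra. -/
def vertexIdem (K : Type u) {V : Type v} [Field K] [Quiver.{w} V] (a : V) : PathAlgebra K V :=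
  ofPath K (Quiver.Path.nil : Quiver.Path a a)

variable [Fintype V]

theorem sum_vertexIdem_mul (x : PathAlgebra K V) :
    mulHom K V (∑ a : V, vertexIdem K a) x = x := by
  induction x using induction_on with
  | zero => simp
  | add x y hx hy => rw [map_add, hx, hy]
  | smul k p =>
    rename_i a b
    rw [map_smul, map_sum, LinearMap.sum_apply, Finset.sum_eq_single a]
    · rw [vertexIdem, mulHom_comp, Quiver.Path.nil_comp]
    · intro c _ hc
      exact mulHom_ne _ _ hc
    · intro h
      exact absurd (Finset.mem_univ a) h

theorem mul_sum_vertexIdem (x : PathAlgebra K V) :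
    mulHom K V x (∑ a : V, vertexIdem K a) = x := by
  induction x using induction_on with
  | zero => simp
  | add x y hx hy => rw [map_add, LinearMap.add_apply, hx, hy]
  | smul k p =>
    rename_i a b
    rw [map_smul, LinearMap.smul_apply, map_sum, Finset.sum_eq_single b]
    · rw [vertexIdem, mulHom_comp, Quiver.Path.comp_nil]
    · intro c _ hc
      exact mulHom_ne _ _ (Ne.symm hc)
    · intro h
      exact absurd (Finset.mem_univ b) h

instance : Ring (PathAlgebra K V) where
  __ := (inferInstance : AddCommGroup (PathAlgebra K V))
  mul x y := mulHom K V x y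
  one := ∑ a : V, vertexIdem K a
  left_distrib x y z := map_add (mulHom K V x) y z
  right_distrib x y z := by
    change mulHom K V (x + y) z = mulHom K V x z + mulHom K V y z
    rw [map_add, LinearMap.add_apply]
  zero_mul x := by
    change mulHom K V 0 x = 0
    rw [map_zero, LinearMap.zero_apply]
  mul_zero x := map_zero (mulHom K V x)
  mul_assoc := mulHom_assoc
  one_mul := sum_vertexIdem_mul
  mul_one := mul_sum_vertexIdem

instance : Algebra K (PathAlgebra K V) :=
  Algebra.ofModule
    (fun k x y => by
      change mulHom K V (k • x) y = k • mulHom K V x y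
      rw [map_smul, LinearMap.smul_apply])
    (fun k x y => map_smul (mulHom K V x) k y)

/-- The arrow ideal of the path algebra: the span of all paths of length at least one. -/
def arrowIdeal (K : Type u) (V : Type v) [Field K] [Quiver.{w} V] :
    Submodule K (PathAlgebra K V) :=
  Submodule.span K {x | ∃ (a b : V) (p : Quiver.Path a b), 1 ≤ p.length ∧ x = ofPath K p}

/-- An ideal `I` of `KQ` is admissible if `R ^ m ⊆ I ⊆ R ^ 2` for some `m ≥ 2`, where `R` is the
arrow ideal. -/
def IsAdmissible (I : Ideal (PathAlgebra K V)) : Prop :=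
  ∃ m : ℕ, 2 ≤ m ∧ arrowIdeal K V ^ m ≤ I.restrictScalars K ∧
    I.restrictScalars K ≤ arrowIdeal K V ^ 2

/-- A minimal relation of `I`: an element of `e_a I e_b`, for some vertices `a` and `b`, which does
not lie in `R I + I R`, where `R` is the arrow ideal (so that it is a minimal generator of `I`). -/
def IsMinimalRelation (I : Ideal (PathAlgebra K V)) (ρ : PathAlgebra K V) : Prop :=
  ρ ∈ I ∧ (∃ a b : V, vertexIdem K a * ρ * vertexIdem K b = ρ) ∧
    ρ ∉ arrowIdeal K V * I.restrictScalars K + I.restrictScalars K * arrowIdeal K V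

/-- The relation `p ≺ I`: the path `p` occurs, with non-zero coefficient, in some minimal relation
of `I`. -/
def OccursIn {a b : V} (p : Quiver.Path a b) (I : Ideal (PathAlgebra K V)) : Prop :=
  ∃ ρ : PathAlgebra K V, IsMinimalRelation I ρ ∧ ρ.coeff ⟨a, b, p⟩ ≠ 0

end PathAlgebra

/-! ### Symmetric algebras -/

/-- A symmetric algebra: there is a non-degenerate, symmetric, associative bilinear form. -/
def IsSymmAlgebra (K : Type u) (A : Type v) [Field K] [Ring A] [Algebra K A] : Prop :=
  ∃ B : LinearMap.BilinForm K A, B.Nondegenerate ∧ (∀ x y : A, B x y = B y x) ∧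
    ∀ x y z : A, B (x * y) z = B x (y * z)

/-! ### Syzygies and periodic algebras -/

/-- `N` is the syzygy `Ω(M)`: it is isomorphic to the kernel of a projective cover `π : P → M`,
that is, of an epimorphism from a (finitely generated) projective module with superfluous kernel. -/
def IsSyzygy {R : Type u} [Ring R] (M N : ModuleCat.{v} R) : Prop :=
  ∃ (P : ModuleCat.{v} R) (π : P →ₗ[R] M), Module.Projective R P ∧ Module.Finite R P ∧
    Function.Surjective π ∧
    (∀ U : Submodule R P, LinearMap.ker π ⊔ U = ⊤ → U = ⊤) ∧
    Nonempty (N ≃ₗ[R] LinearMap.ker π)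

/-- `N` is the iterated syzygy `Ω^n(M)`. -/
def IsIteratedSyzygy {R : Type u} [Ring R] : ℕ → ModuleCat.{v} R → ModuleCat.{v} R → Prop
  | 0, M, N => Nonempty (N ≃ₗ[R] M)
  | n + 1, M, N => ∃ L : ModuleCat.{v} R, IsSyzygy M L ∧ IsIteratedSyzygy n L N

/-- `M` is a periodic module of period `d`: `d` is the smallest positive integer with
`Ω^d(M) ≅ M`. -/
def HasPeriod {R : Type u} [Ring R] (M : ModuleCat.{v} R) (d : ℕ) : Prop :=
  IsLeast {n : ℕ | 1 ≤ n ∧ IsIteratedSyzygy n M M} d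

/-- The algebra `A` as a module over its enveloping algebra, `(a ⊗ b) x = a x b`. -/
def regularBimodule (K : Type u) (A : Type v) [Field K] [Ring A] [Algebra K A] :
    ModuleCat.{v} (A ⊗[K] Aᵐᵒᵖ) :=
  letI : Module (A ⊗[K] Aᵐᵒᵖ) A := TensorProduct.Algebra.module
  ModuleCat.of (A ⊗[K] Aᵐᵒᵖ) A

/-- `A` is a periodic algebra of period `d`: it is periodic of period `d` as a bimodule. -/
def IsPeriodicAlgebra (K : Type u) (A : Type v) [Field K] [Ring A] [Algebra K A] (d : ℕ) : Prop :=
  HasPeriod (regularBimodule K A) d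

/-! ### Tame algebras -/

/-- An indecomposable module. -/
def IsIndecomposableModule (R : Type u) (M : Type v) [Ring R] [AddCommGroup M] [Module R M] :
    Prop :=
  Nontrivial M ∧ ∀ U W : Submodule R M, IsCompl U W → U = ⊥ ∨ W = ⊥

/-- A `K[X]`-`A`-bimodule (on which `K` acts centrally) which is free of finite rank as a left
`K[X]`-module. -/
structure OneParameterFamily (K : Type u) (A : Type v) [Field K] [Ring A] [Algebra K A] where
  carrier : Type u
  [addCommGroup : AddCommGroup carrier]
  [polyModule : Module (Polynomial K) carrier]
  [rightModule : Module Aᵐᵒᵖ carrier]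
  [smulComm : SMulCommClass (Polynomial K) Aᵐᵒᵖ carrier]
  central : ∀ (c : K) (x : carrier),
    (Polynomial.C c : Polynomial K) • x = (algebraMap K Aᵐᵒᵖ c) • x
  [free : Module.Free (Polynomial K) carrier]
  [finite : Module.Finite (Polynomial K) carrier]

attribute [instance] OneParameterFamily.addCommGroup OneParameterFamily.polyModule
  OneParameterFamily.rightModule OneParameterFamily.smulComm

/-- The right `A`-module `K[X]/(X - c) ⊗ N` of a one-parameter family `N` (tensor product over
`K[X]`, written with the factors exchanged). -/
abbrev OneParameterFamily.specialization {K : Type u} {A : Type v} [Field K] [Ring A] [Algebra K A]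
    (N : OneParameterFamily K A) (c : K) : Type u :=
  N.carrier ⊗[Polynomial K]
    (Polynomial K ⧸ Ideal.span {(Polynomial.X - Polynomial.C c : Polynomial K)})

/-- A tame algebra: for each dimension `d`, all but finitely many isomorphism classes of
indecomposable right modules of dimension `d` are obtained by specialization from finitely many
one-parameter families. (Every finite-dimensional module has a copy in the universe of `K`.) -/
def IsTameAlgebra (K : Type u) (A : Type v) [Field K] [Ring A] [Algebra K A] : Prop :=
  ∀ d : ℕ, 1 ≤ d → ∃ (n : ℕ) (N : Fin n → OneParameterFamily K A)
    (m : ℕ) (E : Fin m → ModuleCat.{u} Aᵐᵒᵖ),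
    ∀ (M : Type u) [AddCommGroup M] [Module K M] [Module Aᵐᵒᵖ M] [IsScalarTower K Aᵐᵒᵖ M],
      IsIndecomposableModule Aᵐᵒᵖ M → Module.finrank K M = d →
        (∃ i : Fin m, Nonempty (M ≃ₗ[Aᵐᵒᵖ] E i)) ∨
        (∃ (i : Fin n) (c : K), Nonempty (M ≃ₗ[Aᵐᵒᵖ] (N i).specialization c))

end

/-! ### Vertices of quivers -/

namespace Quiver

variable {V : Type v} [Quiver.{w} V]

/-- A connected quiver: any two vertices are joined by a walk of unoriented arrows. -/
def IsConnectedQuiver (V : Type v) [Quiver.{w} V] : Prop :=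
  Nonempty V ∧ Subsingleton (WeaklyConnectedComponent V)

/-- A biserial quiver: at each vertex at most two arrows start and at most two arrows end. -/
def IsBiserial (V : Type v) [Quiver.{w} V] : Prop :=
  ∀ i : V, Nat.card (Star i) ≤ 2 ∧ Nat.card (Costar i) ≤ 2

/-- A regular vertex: one arrow starts and one ends at it, or two start and two end. -/
def IsRegularVertex (i : V) : Prop :=
  Nat.card (Costar i) = Nat.card (Star i) ∧ (Nat.card (Star i) = 1 ∨ Nat.card (Star i) = 2)

/-- A `(1,2)`-vertex: one arrow ends and two arrows start at it. -/
def IsOneTwoVertex (i : V) : Prop := Nat.card (Costar i) = 1 ∧ Nat.card (Star i) = 2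

/-- A `(2,1)`-vertex: two arrows end and one arrow starts at it. -/
def IsTwoOneVertex (i : V) : Prop := Nat.card (Costar i) = 2 ∧ Nat.card (Star i) = 1

/-- A proper `(1,2)`-vertex (`(2,1)`-vertex): the two arrows which start (end) at it have distinct
targets (sources). -/
def IsProperVertex (i : V) : Prop :=
  (IsOneTwoVertex i ∧ ∀ β β' : Star i, β ≠ β' → β.1 ≠ β'.1) ∨
    (IsTwoOneVertex i ∧ ∀ α α' : Costar i, α ≠ α' → α.1 ≠ α'.1)

/-- A `(1,2)`- or `(2,1)`-vertex `i` is of type R if both paths `αβ` of length two through `i`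
satisfy `αβ ≺ I`. -/
def IsTypeR {K : Type u} [Field K] [Fintype V] (I : Ideal (PathAlgebra K V)) (i : V) : Prop :=
  (IsOneTwoVertex i ∨ IsTwoOneVertex i) ∧
    ∀ (α : Costar i) (β : Star i), PathAlgebra.OccursIn (α.2.toPath.comp β.2.toPath) I

end Quiver

/-!
Write `S` for the simple left module at a vertex `a`. Tensoring a bimodule resolution of `Λ` with
`S`, the period four gives `Ω⁴ S ≅ S`, hence `Ω² S ≅ Ω⁻² S`, since `Λ` is self-injective. The left
side consists of the relations between the arrows which end at `a`. By symmetry, the right side is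
the cokernel of the map from `Λ e_a` given by right multiplication with the arrows which start at
`a`. So the relations at `a` have generators `φ_δ` indexed by the arrows `δ` which start at `a`, and
these satisfy `∑ δ φ_δ = 0`.

Let `α : j ⟶ i` be the only arrow which ends at `i`, and suppose that `αβ` and `αβ'` occur in
relations, where `β` and `β'` have distinct targets. If `αβ` occurs, some `φ_δ` with `δ` from the
target of `β` to `j` contains it, and `∑ δ φ_δ = 0` then gives `w α = 0` for some `w` which has `δ`
in its linear part. The arrows `δ` and `δ'` obtained in this way are all the arrows which end at
`j`, so by nilpotency the radical annihilates `α` from the left. As `α` is not a loop, this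
contradicts symmetry. The case of a `(2,1)`-vertex is dual.
-/

theorem eq_or_eq_of_card_le_two {α : Type*} [Finite α] (h : Nat.card α ≤ 2) {x y : α} (hxy : x ≠ y)
    (z : α) : z = x ∨ z = y := by
  have : Nontrivial α := ⟨x, y, hxy⟩
  have hcard : Nat.card α = 2 := h.antisymm Finite.one_lt_card
  refine or_iff_not_imp_left.2 fun hz => ?_
  exact ((Nat.card_eq_two_iff' x).1 hcard).unique hz hxy.symm

theorem le_of_le_sup_mul_self {R : Type*} {A : Type*} [CommSemiring R] [Semiring A] [Algebra R A]
    {J U : Submodule R A} (hJ : IsNilpotent J) (hU : J * U ≤ U ∨ U * J ≤ U) (h : J ≤ U ⊔ J * J) :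
    J ≤ U := by
  have hpow (n : ℕ) : J ≤ U ⊔ J ^ (n + 1) := by
    induction n with
    | zero => rw [zero_add, pow_one]; exact le_sup_right
    | succ n ih =>
      refine h.trans (sup_le le_sup_left ?_)
      obtain hU | hU := hU
      · calc J * J ≤ J * (U ⊔ J ^ (n + 1)) := by gcongr
          _ = J * U ⊔ J ^ (n + 2) := by rw [Submodule.mul_sup, ← pow_succ']
          _ ≤ U ⊔ J ^ (n + 2) := sup_le_sup_right hU _
      · calc J * J ≤ (U ⊔ J ^ (n + 1)) * J := by gcongr
          _ = U * J ⊔ J ^ (n + 2) := by rw [Submodule.sup_mul, ← pow_succ]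
          _ ≤ U ⊔ J ^ (n + 2) := sup_le_sup_right hU _
  obtain ⟨n, hn⟩ := hJ
  have hn' : J ^ (n + 1) = ⊥ := pow_eq_zero_of_le n.le_succ hn
  exact (hpow n).trans (by rw [hn', sup_bot_eq])

/-! ### Stable retracts -/

section StableRetract

variable {R : Type u} [Ring R] {L M N : Type*} [AddCommGroup L] [AddCommGroup M] [AddCommGroup N]
  [Module R L] [Module R M] [Module R N]

/-- A linear map which is zero in the stable category: it factors through a free module of finite
rank. -/
def FactorsThroughFree (h : M →ₗ[R] N) : Prop :=
  ∃ (n : ℕ) (s : M →ₗ[R] Fin n → R) (t : (Fin n → R) →ₗ[R] N), t ∘ₗ s = h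

namespace FactorsThroughFree

theorem zero : FactorsThroughFree (0 : M →ₗ[R] N) :=
  ⟨0, 0, 0, rfl⟩

theorem add {h h' : M →ₗ[R] N} (hh : FactorsThroughFree h) (hh' : FactorsThroughFree h') :
    FactorsThroughFree (h + h') := by
  obtain ⟨m, s, t, rfl⟩ := hh
  obtain ⟨n, s', t', rfl⟩ := hh'
  let e : (Fin (m + n) → R) ≃ₗ[R] (Fin m → R) × (Fin n → R) :=
    (LinearEquiv.funCongrLeft R R finSumFinEquiv).trans (LinearEquiv.sumArrowLequivProdArrow ..)
  exact ⟨m + n, e.symm.toLinearMap ∘ₗ s.prod s', t.coprod t' ∘ₗ e.toLinearMap,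
    LinearMap.ext fun x => by simp⟩

theorem comp_left {h : L →ₗ[R] M} (hh : FactorsThroughFree h) (g : M →ₗ[R] N) :
    FactorsThroughFree (g ∘ₗ h) := by
  obtain ⟨n, s, t, rfl⟩ := hh
  exact ⟨n, s, g ∘ₗ t, rfl⟩

theorem comp_right {h : M →ₗ[R] N} (hh : FactorsThroughFree h) (f : L →ₗ[R] M) :
    FactorsThroughFree (h ∘ₗ f) := by
  obtain ⟨n, s, t, rfl⟩ := hh
  exact ⟨n, s ∘ₗ f, t, rfl⟩

theorem of_projective [Module.Finite R M] [Module.Projective R M] (s : L →ₗ[R] M)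
    (t : M →ₗ[R] N) : FactorsThroughFree (t ∘ₗ s) := by
  obtain ⟨n, b, a, -, -, hba⟩ := Module.Finite.exists_comp_eq_id_of_projective R M
  exact ⟨n, a ∘ₗ s, t ∘ₗ b, LinearMap.ext fun x => congrArg t (LinearMap.congr_fun hba (s x))⟩

end FactorsThroughFree

/-- `M` is a retract of `M'` in the stable category. -/
def IsStableRetract (R : Type u) [Ring R] (M M' : Type*) [AddCommGroup M] [AddCommGroup M']
    [Module R M] [Module R M'] : Prop :=
  ∃ (f : M →ₗ[R] M') (g : M' →ₗ[R] M), FactorsThroughFree (LinearMap.id - g ∘ₗ f)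

theorem IsStableRetract.of_linearEquiv (e : M ≃ₗ[R] N) : IsStableRetract R M N :=
  ⟨e, e.symm, by simpa using FactorsThroughFree.zero⟩

theorem IsStableRetract.trans (h : IsStableRetract R L M) (h' : IsStableRetract R M N) :
    IsStableRetract R L N := by
  obtain ⟨f, g, hfg⟩ := h
  obtain ⟨f', g', hfg'⟩ := h'
  refine ⟨f' ∘ₗ f, g ∘ₗ g', ?_⟩
  convert hfg.add ((hfg'.comp_right f).comp_left g) using 1
  ext x
  simp

/-- `N` is a syzygy of `M`, up to projective direct summands: it is the kernel of an epimorphism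
from a finitely generated projective module onto `M`. -/
def IsWeakSyzygy (R : Type u) [Ring R] (M N : Type v) [AddCommGroup M] [AddCommGroup N]
    [Module R M] [Module R N] : Prop :=
  ∃ (P : Type v) (_ : AddCommGroup P) (_ : Module R P) (i : N →ₗ[R] P) (p : P →ₗ[R] M),
    Module.Projective R P ∧ Module.Finite R P ∧
      Function.Injective i ∧ Function.Surjective p ∧ Function.Exact i p

/-- `N` is a second syzygy of `M`, up to projective direct summands. -/
def IsWeakSecondSyzygy (R : Type u) [Ring R] (M N : Type v) [AddCommGroup M] [AddCommGroup N]
    [Module R M] [Module R N] : Prop :=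
  ∃ (L : Type v) (_ : AddCommGroup L) (_ : Module R L), IsWeakSyzygy R M L ∧ IsWeakSyzygy R L N

theorem IsWeakSecondSyzygy.of_exact {M N P₀ P₁ : Type v} [AddCommGroup M] [AddCommGroup N]
    [AddCommGroup P₀] [AddCommGroup P₁] [Module R M] [Module R N] [Module R P₀] [Module R P₁]
    [Module.Projective R P₀] [Module.Finite R P₀] [Module.Projective R P₁] [Module.Finite R P₁]
    {i : N →ₗ[R] P₁} {d : P₁ →ₗ[R] P₀} {p : P₀ →ₗ[R] M} (hi : Function.Injective i)
    (hid : Function.Exact i d) (hdp : Function.Exact d p) (hp : Function.Surjective p) :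
    IsWeakSecondSyzygy R M N :=
  ⟨LinearMap.range d, inferInstance, inferInstance,
    ⟨P₀, inferInstance, inferInstance, (LinearMap.range d).subtype, p, inferInstance,
      inferInstance, Subtype.val_injective, hp, fun x => by simpa using hdp x⟩,
    ⟨P₁, inferInstance, inferInstance, i, d.rangeRestrict, inferInstance, inferInstance, hi,
      d.surjective_rangeRestrict, fun x => by
        rw [← hid x, Subtype.ext_iff, ZeroMemClass.coe_zero]; rfl⟩⟩

theorem exists_comp_eq_of_surjective {p : L →ₗ[R] M} (hp : Function.Surjective p)
    (h : L →ₗ[R] N) (hh : LinearMap.ker p ≤ LinearMap.ker h) : ∃ k : M →ₗ[R] N, k ∘ₗ p = h :=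
  ⟨(LinearMap.ker p).liftQ h hh ∘ₗ (p.quotKerEquivOfSurjective hp).symm.toLinearMap,
    LinearMap.ext fun x => by simp⟩

theorem exists_comp_eq_of_injective {i : M →ₗ[R] N} (hi : Function.Injective i)
    (h : L →ₗ[R] N) (hh : LinearMap.range h ≤ LinearMap.range i) : ∃ k : L →ₗ[R] M, i ∘ₗ k = h :=
  ⟨(LinearEquiv.ofInjective i hi).symm.toLinearMap ∘ₗ h.codRestrict _ fun x => hh ⟨x, rfl⟩,
    LinearMap.ext fun x => by simp⟩

theorem IsStableRetract.syzygy {M₁ M₂ N₁ N₂ : Type v} [AddCommGroup M₁] [AddCommGroup M₂]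
    [AddCommGroup N₁] [AddCommGroup N₂] [Module R M₁] [Module R M₂] [Module R N₁] [Module R N₂]
    (h : IsStableRetract R M₁ M₂) (h₁ : IsWeakSyzygy R M₁ N₁) (h₂ : IsWeakSyzygy R M₂ N₂) :
    IsStableRetract R N₁ N₂ := by
  obtain ⟨f, g, n, s, t, hst⟩ := h
  obtain ⟨P₁, _, _, i₁, p₁, _, _, hi₁, hp₁, e₁⟩ := h₁
  obtain ⟨P₂, _, _, i₂, p₂, _, _, hi₂, hp₂, e₂⟩ := h₂
  obtain ⟨F, hF⟩ := Module.projective_lifting_property p₂ (f ∘ₗ p₁) hp₂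
  obtain ⟨G, hG⟩ := Module.projective_lifting_property p₁ (g ∘ₗ p₂) hp₁
  obtain ⟨T, hT⟩ := Module.projective_lifting_property p₁ t hp₁
  have hpi₁ : p₁ ∘ₗ i₁ = 0 := e₁.linearMap_comp_eq_zero
  have hpi₂ : p₂ ∘ₗ i₂ = 0 := e₂.linearMap_comp_eq_zero
  obtain ⟨f', hf'⟩ := exists_comp_eq_of_injective hi₂ (F ∘ₗ i₁) <| by
    rw [← e₂.linearMap_ker_eq, LinearMap.range_le_ker_iff, ← LinearMap.comp_assoc, hF,
      LinearMap.comp_assoc, hpi₁, LinearMap.comp_zero]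
  obtain ⟨g', hg'⟩ := exists_comp_eq_of_injective hi₁ (G ∘ₗ i₂) <| by
    rw [← e₁.linearMap_ker_eq, LinearMap.range_le_ker_iff, ← LinearMap.comp_assoc, hG,
      LinearMap.comp_assoc, hpi₂, LinearMap.comp_zero]
  obtain ⟨θ, hθ⟩ := exists_comp_eq_of_injective hi₁ (LinearMap.id - G ∘ₗ F - T ∘ₗ s ∘ₗ p₁) <| by
    rw [← e₁.linearMap_ker_eq, LinearMap.range_le_ker_iff, LinearMap.comp_sub, LinearMap.comp_sub,
      ← LinearMap.comp_assoc, ← LinearMap.comp_assoc, hG, hT, ← LinearMap.comp_assoc, hst,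
      LinearMap.comp_assoc, hF, LinearMap.sub_comp, LinearMap.comp_assoc, LinearMap.comp_id,
      LinearMap.id_comp, sub_self]
  refine ⟨f', g', ?_⟩
  suffices LinearMap.id - g' ∘ₗ f' = θ ∘ₗ i₁ from this ▸ .of_projective i₁ θ
  rw [← LinearMap.cancel_left hi₁]
  simp only [LinearMap.comp_sub, ← LinearMap.comp_assoc, hg', hθ]
  simp only [LinearMap.sub_comp, LinearMap.comp_assoc, hf', hpi₁, LinearMap.comp_zero, sub_zero,
    LinearMap.id_comp, LinearMap.comp_id]

theorem baer_of_projective (hR : Module.Baer R R) [Module.Projective R M] [Module.Finite R M] :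
    Module.Baer R M := by
  obtain ⟨n, b, a, -, -, hba⟩ := Module.Finite.exists_comp_eq_id_of_projective R M
  intro I h
  choose g hg using fun k => hR I (LinearMap.proj k ∘ₗ a ∘ₗ h)
  refine ⟨b ∘ₗ LinearMap.pi g, fun x hx => ?_⟩
  have hgx : LinearMap.pi g x = a (h ⟨x, hx⟩) := funext fun k => hg k x hx
  rw [LinearMap.comp_apply, hgx, ← LinearMap.comp_apply, hba, LinearMap.id_apply]

theorem IsStableRetract.cosyzygy (hR : Module.Baer R R) {M₁ M₂ N₁ N₂ : Type v} [AddCommGroup M₁]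
    [AddCommGroup M₂] [AddCommGroup N₁] [AddCommGroup N₂] [Module R M₁] [Module R M₂]
    [Module R N₁] [Module R N₂] (h : IsStableRetract R N₁ N₂) (h₁ : IsWeakSyzygy R M₁ N₁)
    (h₂ : IsWeakSyzygy R M₂ N₂) : IsStableRetract R M₁ M₂ := by
  obtain ⟨f, g, n, s, t, hst⟩ := h
  obtain ⟨P₁, _, _, i₁, p₁, _, _, hi₁, hp₁, e₁⟩ := h₁
  obtain ⟨P₂, _, _, i₂, p₂, _, _, hi₂, hp₂, e₂⟩ := h₂
  obtain ⟨F, hF⟩ := (baer_of_projective hR).extension_property i₁ hi₁ (i₂ ∘ₗ f)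
  obtain ⟨G, hG⟩ := (baer_of_projective hR).extension_property i₂ hi₂ (i₁ ∘ₗ g)
  obtain ⟨S, hS⟩ := (baer_of_projective hR).extension_property i₁ hi₁ s
  have hpi₁ : p₁ ∘ₗ i₁ = 0 := e₁.linearMap_comp_eq_zero
  have hpi₂ : p₂ ∘ₗ i₂ = 0 := e₂.linearMap_comp_eq_zero
  obtain ⟨f', hf'⟩ := exists_comp_eq_of_surjective hp₁ (p₂ ∘ₗ F) <| by
    rw [e₁.linearMap_ker_eq, LinearMap.range_le_ker_iff, LinearMap.comp_assoc, hF,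
      ← LinearMap.comp_assoc, hpi₂, LinearMap.zero_comp]
  obtain ⟨g', hg'⟩ := exists_comp_eq_of_surjective hp₂ (p₁ ∘ₗ G) <| by
    rw [e₂.linearMap_ker_eq, LinearMap.range_le_ker_iff, LinearMap.comp_assoc, hG,
      ← LinearMap.comp_assoc, hpi₁, LinearMap.zero_comp]
  obtain ⟨θ, hθ⟩ := exists_comp_eq_of_surjective hp₁ (LinearMap.id - G ∘ₗ F - i₁ ∘ₗ t ∘ₗ S) <| by
    rw [e₁.linearMap_ker_eq, LinearMap.range_le_ker_iff]
    simp only [LinearMap.sub_comp, LinearMap.comp_assoc, hF, hS, hst]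
    rw [← LinearMap.comp_assoc, hG, LinearMap.comp_sub, LinearMap.comp_assoc, LinearMap.comp_id,
      LinearMap.id_comp, sub_self]
  refine ⟨f', g', ?_⟩
  suffices LinearMap.id - g' ∘ₗ f' = p₁ ∘ₗ θ from this ▸ .of_projective θ p₁
  rw [← LinearMap.cancel_right hp₁, LinearMap.sub_comp, LinearMap.comp_assoc, hf',
    ← LinearMap.comp_assoc, hg', LinearMap.comp_assoc, LinearMap.comp_assoc, hθ]
  simp only [LinearMap.comp_sub, ← LinearMap.comp_assoc, hpi₁, LinearMap.zero_comp, sub_zero,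
    LinearMap.id_comp, LinearMap.comp_id]

theorem eq_top_of_jacobson_sup_eq_top [Module.Finite R M] {U : Submodule R M}
    (hU : Module.jacobson R M ⊔ U = ⊤) : U = ⊤ := by
  obtain hU' | ⟨W, hW, hUW⟩ := eq_top_or_exists_le_coatom U
  · exact hU'
  · exact absurd (top_le_iff.1 (hU ▸ sup_le (sInf_le hW) hUW)) hW.1

theorem IsStableRetract.exists_surjective (hR : Module.Baer R R) [Module.Finite R N]
    (h : IsStableRetract R N M) {i : N →ₗ[R] L} (hi : Function.Injective i)
    (hrad : LinearMap.range i ≤ Module.jacobson R L) :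
    ∃ g : M →ₗ[R] N, Function.Surjective g := by
  obtain ⟨f, g, n, s, t, hst⟩ := h
  obtain ⟨S, hS⟩ := (baer_of_projective hR).extension_property i hi s
  refine ⟨g, LinearMap.range_eq_top.1 (eq_top_of_jacobson_sup_eq_top (top_le_iff.1 ?_))⟩
  intro x _
  have hts : t (s x) ∈ Module.jacobson R N := by
    rw [← hS]
    exact Module.map_jacobson_le (t ∘ₗ S) (Submodule.mem_map_of_mem (hrad ⟨x, rfl⟩))
  have hx : t (s x) + g (f x) = x := by
    rw [← LinearMap.comp_apply, hst, LinearMap.sub_apply]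
    simp only [LinearMap.id_apply, LinearMap.comp_apply, sub_add_cancel]
  exact hx ▸ Submodule.add_mem_sup hts ⟨f x, rfl⟩

end StableRetract

/-! ### Base change along a surjective ring homomorphism -/

noncomputable section BaseChange

variable {S E A : Type*} [Ring S] [Ring E] [Ring A]

/-- The extension of scalars `A ⊗ M` of an `E`-module `M` along a surjective ring homomorphism
`ε : E → A`, as the quotient of `M` by `ker ε • M`. -/
def BaseChange (ε : E →+* A) (M : Type*) [AddCommGroup M] [Module E M] : Type _ :=
  M ⧸ (RingHom.ker ε • ⊤ : Submodule E M)

namespace BaseChange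

variable (ε : E →+* A) [hε : RingHomSurjective ε] {L M N : Type*} [AddCommGroup L] [AddCommGroup M]
  [AddCommGroup N] [Module E L] [Module E M] [Module E N]

instance : AddCommGroup (BaseChange ε M) :=
  inferInstanceAs (AddCommGroup (M ⧸ (RingHom.ker ε • ⊤ : Submodule E M)))

instance : Module A (BaseChange ε M) :=
  Module.compHom (M ⧸ (RingHom.ker ε • ⊤ : Submodule E M))
    (RingHom.quotientKerEquivOfSurjective hε.is_surjective).symm.toRingHom

/-- The canonical map from a module to its base change. -/
def mk : M →ₛₗ[ε] BaseChange ε M where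
  toFun := Submodule.Quotient.mk
  map_add' _ _ := rfl
  map_smul' r x := by
    change _ = (RingHom.quotientKerEquivOfSurjective hε.is_surjective).symm (ε r) •
      (Submodule.Quotient.mk x : M ⧸ (RingHom.ker ε • ⊤ : Submodule E M))
    rw [← RingHom.quotientKerEquivOfSurjective_apply_mk hε.is_surjective,
      RingEquiv.symm_apply_apply]
    rfl

theorem mk_surjective : Function.Surjective (mk ε : M →ₛₗ[ε] BaseChange ε M) :=
  Submodule.mkQ_surjective _

theorem mk_eq_zero {x : M} : mk ε x = 0 ↔ x ∈ (RingHom.ker ε • ⊤ : Submodule E M) :=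
  Submodule.Quotient.mk_eq_zero _

variable {X : Type*} [AddCommGroup X] [Module A X]

/-- The linear map on the base change induced by a semilinear map. -/
def lift (f : M →ₛₗ[ε] X) : BaseChange ε M →ₗ[A] X where
  __ := (RingHom.ker ε • ⊤ : Submodule E M).liftQ f <| Submodule.smul_le.2 fun r hr x _ => by
    rw [LinearMap.mem_ker, map_smulₛₗ, RingHom.mem_ker.1 hr, zero_smul]
  map_smul' a y := by
    obtain ⟨r, rfl⟩ := hε.is_surjective a
    obtain ⟨x, rfl⟩ := mk_surjective ε y
    exact congrArg _ (map_smulₛₗ (mk ε) r x).symm |>.trans (map_smulₛₗ f r x)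

/-- The functoriality of the base change. -/
def map (f : M →ₗ[E] N) : BaseChange ε M →ₗ[A] BaseChange ε N :=
  lift ε ((mk ε).comp f)

theorem map_mk (f : M →ₗ[E] N) (x : M) : map ε f (mk ε x) = mk ε (f x) := rfl

theorem map_surjective {f : M →ₗ[E] N} (hf : Function.Surjective f) :
    Function.Surjective (map ε f) :=
  .of_comp (g := mk ε) ((mk_surjective ε).comp hf)

theorem map_exact {i : L →ₗ[E] M} {p : M →ₗ[E] N} (hp : Function.Surjective p)
    (e : Function.Exact i p) : Function.Exact (map ε i) (map ε p) := by
  intro y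
  obtain ⟨y, rfl⟩ := mk_surjective ε y
  constructor
  · intro hy
    have hpy : p y ∈ ((RingHom.ker ε • ⊤ : Submodule E M).map p) := by
      rw [Submodule.map_smul'', Submodule.map_top, LinearMap.range_eq_top.2 hp]
      exact (mk_eq_zero ε).1 hy
    obtain ⟨z, hz, hzy⟩ := hpy
    obtain ⟨x, hx⟩ := (e (y - z)).1 (by rw [map_sub, hzy, sub_self])
    exact ⟨mk ε x, by rw [map_mk, hx, map_sub, (mk_eq_zero ε).2 hz, sub_zero]⟩
  · rintro ⟨x, hx⟩
    obtain ⟨x, rfl⟩ := mk_surjective ε x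
    rw [← hx, map_mk, map_mk, e.apply_apply_eq_zero, map_zero]

theorem projective [Module.Finite E M] [Module.Projective E M] :
    Module.Projective A (BaseChange ε M) := by
  obtain ⟨n, b, a, -, -, hba⟩ := Module.Finite.exists_comp_eq_id_of_projective E M
  let a' : M →ₛₗ[ε] Fin n → A :=
    { toFun x k := ε (a x k)
      map_add' x y := by ext; simp
      map_smul' r x := by ext; simp }
  refine .of_split (lift ε a')
    (Fintype.linearCombination A fun k => mk ε (b fun l => if k = l then 1 else 0)) ?_
  ext y
  obtain ⟨x, rfl⟩ := mk_surjective ε y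
  calc ∑ k, ε (a x k) • mk ε (b fun l => if k = l then 1 else 0)
    _ = mk ε (b (a x)) := by
      simp only [LinearMap.pi_apply_eq_sum_univ b (a x), map_sum, map_smulₛₗ]
    _ = mk ε x := congrArg (mk ε) (LinearMap.congr_fun hba x)

instance [Module.Finite E M] : Module.Finite A (BaseChange ε M) :=
  .of_surjective (mk ε) (mk_surjective ε)

/-- Injectivity is preserved when there is a retraction which is linear over a ring `S` such that
`ker ε` is generated, as a right ideal, by its elements coming from `S`. -/
theorem map_injective (j : S →+* E)
    (hker : (RingHom.ker ε : Set E) ⊆ Submodule.span Eᵐᵒᵖ (j '' RingHom.ker (ε.comp j)))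
    {i : L →ₗ[E] M} {r : M →+ L} (hri : ∀ x, r (i x) = x) (hr : ∀ s x, r (j s • x) = j s • r x) :
    Function.Injective (map ε i) := by
  have hr_smul : ∀ c ∈ Submodule.span Eᵐᵒᵖ (j '' RingHom.ker (ε.comp j)), ∀ x,
      r (c • x) ∈ (RingHom.ker ε • ⊤ : Submodule E L) := by
    intro c hc
    induction hc using Submodule.span_induction with
    | mem c hc =>
      obtain ⟨s, hs, rfl⟩ := hc
      exact fun x => hr s x ▸ Submodule.smul_mem_smul hs Submodule.mem_top
    | zero => simp
    | add c d _ _ hc hd => exact fun x => by rw [add_smul, map_add]; exact add_mem (hc x) (hd x)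
    | smul e c _ hc =>
      exact fun x => by rw [← MulOpposite.op_unop e, op_smul_eq_mul, mul_smul]; exact hc _
  refine (injective_iff_map_eq_zero _).2 fun y hy => ?_
  obtain ⟨x, rfl⟩ := mk_surjective ε y
  rw [map_mk, mk_eq_zero] at hy
  rw [mk_eq_zero, ← hri x]
  exact Submodule.smul_induction_on hy (fun c hc z _ => hr_smul c (hker hc) z)
    fun z z' hz hz' => by rw [map_add]; exact add_mem hz hz'

end BaseChange

section ProjectiveAlong

variable (j : S →+* E)

/-- The `E`-module `M` is projective as a module over `S`, along a ring homomorphism `S → E`. -/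
def IsProjectiveAlong (M : Type*) [AddCommGroup M] [Module E M] : Prop :=
  letI := Module.compHom M j
  Module.Projective S M

variable {j} {L M N : Type*} [AddCommGroup L] [AddCommGroup M] [AddCommGroup N] [Module E L]
  [Module E M] [Module E N]

theorem IsProjectiveAlong.of_projective (hj : IsProjectiveAlong j E) [Module.Projective E M]
    [Module.Finite E M] : IsProjectiveAlong j M := by
  obtain ⟨n, b, a, -, -, hba⟩ := Module.Finite.exists_comp_eq_id_of_projective E M
  let _ := Module.compHom M j
  let _ := Module.compHom E j
  have : Module.Projective S E := hj
  have : Module.Projective S (Fin n → E) := .of_equiv' DFinsupp.linearEquivFunOnFintype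
  refine Module.Projective.of_split (M := Fin n → E)
    { toFun := a, map_add' := map_add a, map_smul' := fun s x => map_smul a (j s) x }
    { toFun := b, map_add' := map_add b, map_smul' := fun s x => map_smul b (j s) x }
    (LinearMap.ext fun x => LinearMap.congr_fun hba x)

theorem IsProjectiveAlong.exists_retraction (hN : IsProjectiveAlong j N) {i : L →ₗ[E] M}
    {p : M →ₗ[E] N} (hi : Function.Injective i) (hp : Function.Surjective p)
    (e : Function.Exact i p) :
    ∃ r : M →+ L, (∀ x, r (i x) = x) ∧ ∀ s x, r (j s • x) = j s • r x := by
  let _ := Module.compHom L j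
  let _ := Module.compHom M j
  let _ := Module.compHom N j
  have : Module.Projective S N := hN
  let i' : L →ₗ[S] M :=
    { toFun := i, map_add' := map_add i, map_smul' := fun s => map_smul i (j s) }
  let p' : M →ₗ[S] N :=
    { toFun := p, map_add' := map_add p, map_smul' := fun s => map_smul p (j s) }
  obtain ⟨σ, hσ⟩ := p'.exists_rightInverse_of_surjective (LinearMap.range_eq_top.2 hp)
  obtain ⟨r, hr⟩ := exists_comp_eq_of_injective (i := i') hi (LinearMap.id - σ ∘ₗ p') <| by
    rintro _ ⟨x, rfl⟩
    refine (e _).1 (?_ : p' _ = 0)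
    rw [← LinearMap.comp_apply, LinearMap.comp_sub, ← LinearMap.comp_assoc, hσ]
    simp
  refine ⟨r, fun x => hi ((LinearMap.congr_fun hr (i x)).trans ?_), map_smul r⟩
  change i x - σ (p (i x)) = i x
  rw [e.apply_apply_eq_zero, map_zero, sub_zero]

theorem IsProjectiveAlong.of_retraction (hM : IsProjectiveAlong j M) (i : L →ₗ[E] M) {r : M →+ L}
    (hri : ∀ x, r (i x) = x) (hr : ∀ s x, r (j s • x) = j s • r x) : IsProjectiveAlong j L := by
  let _ := Module.compHom L j
  let _ := Module.compHom M j
  have : Module.Projective S M := hM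
  exact .of_split (R := S)
    { toFun := i, map_add' := map_add i, map_smul' := fun s => map_smul i (j s) }
    { toFun := r, map_add' := map_add r, map_smul' := hr } (LinearMap.ext hri)

end ProjectiveAlong

theorem IsSyzygy.baseChange {j : S →+* E} (hj : IsProjectiveAlong j E) (ε : E →+* A)
    [RingHomSurjective ε]
    (hker : (RingHom.ker ε : Set E) ⊆ Submodule.span Eᵐᵒᵖ (j '' RingHom.ker (ε.comp j)))
    {M N : ModuleCat.{w} E} (h : IsSyzygy M N) (hM : IsProjectiveAlong j M) :
    IsWeakSyzygy A (BaseChange ε M) (BaseChange ε N) ∧ IsProjectiveAlong j N := by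
  obtain ⟨P, p, _, _, hp, -, ⟨f⟩⟩ := h
  let i : N →ₗ[E] P := (LinearMap.ker p).subtype ∘ₗ f.toLinearMap
  have hi : Function.Injective i := Subtype.val_injective.comp f.injective
  have hip : Function.Exact i p := by
    rw [LinearMap.exact_iff, LinearMap.range_comp, LinearEquiv.range, Submodule.map_top,
      Submodule.range_subtype]
  obtain ⟨r, hri, hr⟩ := hM.exists_retraction hi hp hip
  exact ⟨⟨BaseChange ε P, inferInstance, inferInstance, BaseChange.map ε i, BaseChange.map ε p,
    BaseChange.projective ε, inferInstance, BaseChange.map_injective ε j hker hri hr,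
    BaseChange.map_surjective ε hp, BaseChange.map_exact ε hp hip⟩,
    (hj.of_projective (M := P)).of_retraction i hri hr⟩

end BaseChange

/-! ### Periodic bimodules -/

noncomputable section EnvelopingAlgebra

variable {K : Type u} {A : Type v} [Field K] [Ring A] [Algebra K A]

/-- The homomorphism `a ⊗ b ↦ χ(b) a` from the enveloping algebra of `A`, for a character `χ`
of `A`. -/
def evalRight (χ : A →ₐ[K] K) : A ⊗[K] Aᵐᵒᵖ →+* A :=
  ((Algebra.TensorProduct.rid K K A).toAlgHom.comp (Algebra.TensorProduct.map (AlgHom.id K A)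
    (χ.fromOpposite fun _ _ => Commute.all _ _)) : A ⊗[K] Aᵐᵒᵖ →ₐ[K] A)

theorem evalRight_tmul (χ : A →ₐ[K] K) (a : A) (b : Aᵐᵒᵖ) :
    evalRight χ (a ⊗ₜ b) = χ b.unop • a :=
  Algebra.TensorProduct.rid_tmul K (χ b.unop) a

instance (χ : A →ₐ[K] K) : RingHomSurjective (evalRight χ) :=
  ⟨fun a => ⟨a ⊗ₜ 1, (evalRight_tmul χ a 1).trans <| by simp⟩⟩

variable (K A) in
/-- The homomorphism `b ↦ 1 ⊗ b` from the opposite algebra to the enveloping algebra. -/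
abbrev opToEnvelope : Aᵐᵒᵖ →+* A ⊗[K] Aᵐᵒᵖ :=
  (Algebra.TensorProduct.includeRight : Aᵐᵒᵖ →ₐ[K] A ⊗[K] Aᵐᵒᵖ)

theorem ker_evalRight_subset (χ : A →ₐ[K] K) :
    (RingHom.ker (evalRight χ) : Set (A ⊗[K] Aᵐᵒᵖ)) ⊆
      Submodule.span (A ⊗[K] Aᵐᵒᵖ)ᵐᵒᵖ (opToEnvelope K A ''
        RingHom.ker ((evalRight χ).comp (opToEnvelope K A))) := by
  intro t ht
  suffices t - evalRight χ t ⊗ₜ 1 ∈ Submodule.span (A ⊗[K] Aᵐᵒᵖ)ᵐᵒᵖ (opToEnvelope K A ''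
      RingHom.ker ((evalRight χ).comp (opToEnvelope K A))) by
    rwa [show evalRight χ t = 0 from ht, TensorProduct.zero_tmul, sub_zero] at this
  clear ht
  induction t using TensorProduct.induction_on with
  | zero => simp
  | add t t' ht ht' =>
    rw [map_add, TensorProduct.add_tmul, add_sub_add_comm]
    exact add_mem ht ht'
  | tmul a b =>
    have hb : a ⊗ₜ b - evalRight χ (a ⊗ₜ b) ⊗ₜ 1 = MulOpposite.op (a ⊗ₜ[K] (1 : Aᵐᵒᵖ)) •
        opToEnvelope K A (b - algebraMap K Aᵐᵒᵖ (χ b.unop)) := by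
      simp [evalRight_tmul, TensorProduct.smul_tmul, TensorProduct.tmul_sub, sub_mul,
        Algebra.algebraMap_eq_smul_one, -TensorProduct.tmul_smul]
    rw [hb]
    refine Submodule.smul_mem _ _ (Submodule.subset_span ⟨_, RingHom.mem_ker.2 ?_, rfl⟩)
    exact (evalRight_tmul χ 1 _).trans (by simp)

theorem isProjectiveAlong_opToEnvelope : IsProjectiveAlong (opToEnvelope K A) (A ⊗[K] Aᵐᵒᵖ) := by
  let _ : Module Aᵐᵒᵖ (A ⊗[K] Aᵐᵒᵖ) := Module.compHom _ (opToEnvelope K A)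
  exact .of_equiv' (M := Aᵐᵒᵖ ⊗[K] A)
    { __ := TensorProduct.comm K Aᵐᵒᵖ A
      map_smul' b t := by
        change TensorProduct.comm K Aᵐᵒᵖ A (b • t) = (1 ⊗ₜ b) * TensorProduct.comm K Aᵐᵒᵖ A t
        induction t using TensorProduct.induction_on with
        | zero => rw [smul_zero, map_zero, mul_zero]
        | add t t' ht ht' => rw [smul_add, map_add, map_add, ht, ht', mul_add]
        | tmul c a => simp [TensorProduct.smul_tmul'] }

variable (K A) in
/-- The identity map from the algebra `A` to the `A`-bimodule `A`. -/
def regularBimoduleEquiv : A ≃+ regularBimodule K A :=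
  AddEquiv.refl A

theorem tmul_smul_regularBimoduleEquiv (a : A) (b : Aᵐᵒᵖ) (x : A) :
    a ⊗ₜ[K] b • regularBimoduleEquiv K A x = regularBimoduleEquiv K A (a * x * b.unop) :=
  (mul_assoc a x b.unop).symm

theorem isProjectiveAlong_regularBimodule :
    IsProjectiveAlong (opToEnvelope K A) (regularBimodule K A) := by
  let _ : Module Aᵐᵒᵖ (regularBimodule K A) := Module.compHom _ (opToEnvelope K A)
  exact .of_equiv' (M := Aᵐᵒᵖ)
    { __ := MulOpposite.opAddEquiv.symm.trans (regularBimoduleEquiv K A)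
      map_smul' b c := by
        refine .trans ?_ (tmul_smul_regularBimoduleEquiv 1 b c.unop).symm
        rw [one_mul]
        rfl }

theorem mk_smul_regularBimodule (χ : A →ₐ[K] K) (t : A ⊗[K] Aᵐᵒᵖ) (x : A) :
    (Submodule.Quotient.mk ((regularBimoduleEquiv K A).symm (t • regularBimoduleEquiv K A x)) :
      A ⧸ RingHom.ker χ) = evalRight χ t • Submodule.Quotient.mk x := by
  induction t using TensorProduct.induction_on with
  | zero =>
    rw [map_zero, zero_smul]
    exact congrArg Submodule.Quotient.mk (zero_smul (A ⊗[K] Aᵐᵒᵖ) (regularBimoduleEquiv K A x))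
  | add t t' ht ht' =>
    rw [add_smul, map_add, Submodule.Quotient.mk_add, ht, ht', map_add, add_smul]
  | tmul a b =>
    rw [tmul_smul_regularBimoduleEquiv, AddEquiv.symm_apply_apply, evalRight_tmul,
      ← Submodule.Quotient.mk_smul, Submodule.Quotient.eq, RingHom.mem_ker]
    simp [mul_comm, mul_left_comm]

/-- The base change of the bimodule `A` along `evalRight χ` is the simple module `A ⧸ ker χ`. -/
def baseChangeRegularBimoduleEquiv (χ : A →ₐ[K] K) :
    BaseChange (evalRight χ) (regularBimodule K A) ≃ₗ[A] A ⧸ RingHom.ker χ :=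
  .ofBijective
    (BaseChange.lift (evalRight χ)
      { toFun x := Submodule.Quotient.mk ((regularBimoduleEquiv K A).symm x)
        map_add' _ _ := rfl
        map_smul' t x := mk_smul_regularBimodule χ t x }) <| by
    constructor
    · refine (injective_iff_map_eq_zero _).2 fun y hy => ?_
      obtain ⟨x, rfl⟩ := BaseChange.mk_surjective (evalRight χ) y
      obtain ⟨x, rfl⟩ := (regularBimoduleEquiv K A).surjective x
      have hx : χ x = 0 := (Submodule.Quotient.mk_eq_zero (RingHom.ker χ)).1 hy
      have h : regularBimoduleEquiv K A x =
          (1 : A) ⊗ₜ[K] MulOpposite.op x • regularBimoduleEquiv K A 1 := by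
        rw [tmul_smul_regularBimoduleEquiv, one_mul, one_mul, MulOpposite.unop_op]
      rw [h, map_smulₛₗ, evalRight_tmul, MulOpposite.unop_op, hx, zero_smul,
        zero_smul]
    · intro y
      obtain ⟨a, rfl⟩ := Submodule.Quotient.mk_surjective _ y
      exact ⟨BaseChange.mk (evalRight χ) (regularBimoduleEquiv K A a), rfl⟩

theorem IsSyzygy.of_linearEquiv {R : Type u} [Ring R] {M N N' : ModuleCat.{v} R}
    (h : IsSyzygy M N) (e : N' ≃ₗ[R] N) : IsSyzygy M N' := by
  obtain ⟨P, p, hP, hfin, hp, hker, ⟨f⟩⟩ := h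
  exact ⟨P, p, hP, hfin, hp, hker, ⟨e.trans f⟩⟩

theorem IsIteratedSyzygy.exists_isWeakSecondSyzygy (χ : A →ₐ[K] K)
    (h : IsIteratedSyzygy 4 (regularBimodule K A) (regularBimodule K A)) :
    ∃ (L : Type v) (_ : AddCommGroup L) (_ : Module A L),
      IsWeakSecondSyzygy A (BaseChange (evalRight χ) (regularBimodule K A)) L ∧
        IsWeakSecondSyzygy A L (BaseChange (evalRight χ) (regularBimodule K A)) := by
  obtain ⟨L₁, h₁, L₂, h₂, L₃, h₃, L₄, h₄, ⟨e⟩⟩ := h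
  have base_change {M N : ModuleCat.{v} (A ⊗[K] Aᵐᵒᵖ)} (h : IsSyzygy M N) :=
    h.baseChange isProjectiveAlong_opToEnvelope (evalRight χ) (ker_evalRight_subset χ)
  obtain ⟨w₁, p₁⟩ := base_change h₁ isProjectiveAlong_regularBimodule
  obtain ⟨w₂, p₂⟩ := base_change h₂ p₁
  obtain ⟨w₃, p₃⟩ := base_change h₃ p₂
  obtain ⟨w₄, -⟩ := base_change (h₄.of_linearEquiv e) p₃
  exact ⟨_, _, _, ⟨_, _, _, w₁, w₂⟩, ⟨_, _, _, w₃, w₄⟩⟩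

/-- Both `M` and `N` are stably isomorphic to the second syzygy of `A ⧸ ker χ` obtained from the
bimodule resolution. -/
theorem IsIteratedSyzygy.isStableRetract (hA : Module.Baer A A) (χ : A →ₐ[K] K)
    (h : IsIteratedSyzygy 4 (regularBimodule K A) (regularBimodule K A)) {M N : Type v}
    [AddCommGroup M] [AddCommGroup N] [Module A M] [Module A N]
    (hM : IsWeakSecondSyzygy A (A ⧸ RingHom.ker χ) M)
    (hN : IsWeakSecondSyzygy A N (A ⧸ RingHom.ker χ)) : IsStableRetract A M N := by
  obtain ⟨L, _, _, ⟨_, _, _, u₁, u₂⟩, ⟨_, _, _, u₃, u₄⟩⟩ := h.exists_isWeakSecondSyzygy χ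
  obtain ⟨_, _, _, v₁, v₂⟩ := hM
  obtain ⟨_, _, _, v₃, v₄⟩ := hN
  have e := baseChangeRegularBimoduleEquiv χ
  have hML : IsStableRetract A M L :=
    ((IsStableRetract.of_linearEquiv e.symm).syzygy v₁ u₁).syzygy v₂ u₂
  have hLN : IsStableRetract A L N :=
    ((IsStableRetract.of_linearEquiv e).cosyzygy hA u₄ v₄).cosyzygy hA u₃ v₃
  exact hML.trans hLN

end EnvelopingAlgebra

/-! ### Symmetric algebras -/

section Symmetric

variable {K : Type u} {A : Type v} [Field K] [Ring A] [Algebra K A]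

/-- A non-degenerate associative symmetric form turns an `A`-linear map `I → A` into a linear form
on `I`; any extension of this form to `A` is represented by an element of `A`. -/
theorem IsSymmAlgebra.baer [FiniteDimensional K A] (h : IsSymmAlgebra K A) : Module.Baer A A := by
  obtain ⟨B, hB, hs, ha⟩ := h
  intro I g
  obtain ⟨l, hl⟩ := LinearMap.exists_extend (p := I.restrictScalars K)
    (B 1 ∘ₗ g.restrictScalars K)
  obtain ⟨q, rfl⟩ := (B.toDual hB).surjective l
  refine ⟨LinearMap.toSpanSingleton A A q, fun x hx => ?_⟩
  refine sub_eq_zero.1 (hB.1 _ fun y => ?_)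
  have hyx : B q (y * x) = B 1 (y * g ⟨x, hx⟩) :=
    (LinearMap.congr_fun hl ⟨y * x, I.mul_mem_left y hx⟩).trans
      (congrArg (B 1) (map_smul g y ⟨x, hx⟩))
  rw [map_sub, LinearMap.sub_apply, sub_eq_zero, LinearMap.toSpanSingleton_apply, smul_eq_mul, ha,
    hs, ha, hyx, ← ha, one_mul, hs]

theorem IsSymmAlgebra.exists_socle [FiniteDimensional K A] (h : IsSymmAlgebra K A)
    (χ : A →ₐ[K] K) :
    ∃ z : A, z ≠ 0 ∧ (∀ a, a * z = χ a • z) ∧ (∀ a, z * a = χ a • z) ∧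
      ∀ p, (∀ a, p * a = χ a • p) → ∃ c : K, p = c • z := by
  obtain ⟨B, hB, hs, ha⟩ := h
  obtain ⟨z, hz⟩ := (B.toDual hB).surjective χ.toLinearMap
  replace hz x : B z x = χ x := LinearMap.congr_fun hz x
  have ext {x y : A} (hxy : ∀ a, B x a = B y a) : x = y :=
    sub_eq_zero.1 (hB.1 _ fun a => by rw [map_sub, LinearMap.sub_apply, hxy, sub_self])
  refine ⟨z, ?_, fun a => ext fun x => ?_, fun a => ext fun x => ?_, fun p hp =>
    ⟨B p 1, ext fun x => ?_⟩⟩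
  · rintro rfl
    simpa using hz 1
  · rw [ha, hs, ha, hz, map_smul, LinearMap.smul_apply, hz, map_mul, smul_eq_mul, mul_comm]
  · rw [ha, hz, map_smul, LinearMap.smul_apply, hz, map_mul, smul_eq_mul]
  · rw [← mul_one x, ← ha, hp, map_smul, map_smul, LinearMap.smul_apply, LinearMap.smul_apply,
      mul_one, hz, smul_eq_mul, smul_eq_mul, mul_comm]

theorem IsSymmAlgebra.eq_zero_of_forall_mul_eq_zero (h : IsSymmAlgebra K A) {ι : Type*} {e : ι → A}
    (he : ∀ i, IsIdempotentElem (e i)) {J : Submodule K A}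
    (hJ : Submodule.span K (Set.range e) ⊔ J = ⊤) {x : A} (hx : ∀ i, e i * x * e i = 0)
    (hxJ : ∀ a ∈ J, x * a = 0 ∨ a * x = 0) : x = 0 := by
  obtain ⟨B, hB, hs, ha⟩ := h
  have apply_eq (y a : A) : B y a = B (y * a) 1 := by rw [ha, mul_one]
  suffices ⊤ ≤ LinearMap.ker (B x) from hB.1 x fun a => this trivial
  rw [← hJ, sup_le_iff, Submodule.span_le, Set.range_subset_iff]
  refine ⟨fun i => ?_, fun a haJ => ?_⟩
  · rw [SetLike.mem_coe, LinearMap.mem_ker, ← he i, ← ha, hs, ← ha, apply_eq, hx,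
      map_zero, LinearMap.zero_apply]
  · obtain hxa | hax := hxJ a haJ
    · rw [LinearMap.mem_ker, apply_eq, hxa, map_zero, LinearMap.zero_apply]
    · rw [LinearMap.mem_ker, hs, apply_eq, hax, map_zero, LinearMap.zero_apply]

end Symmetric

/-! ### Coefficients of short paths -/

noncomputable section

namespace PathAlgebra

variable {K : Type u} {V : Type v} [Field K] [Quiver.{w} V]

/-- The coefficient of a path, as a linear form. -/
def coeffHom (K : Type u) {V : Type v} [Field K] [Quiver.{w} V] (p : Quiver.AnyPath V) :
    PathAlgebra K V →ₗ[K] K :=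
  Finsupp.lapply p

open Classical in
theorem coeffHom_ofPath (p : Quiver.AnyPath V) {a b : V} (q : Quiver.Path a b) :
    coeffHom K p (ofPath K q) = if (⟨a, b, q⟩ : Quiver.AnyPath V) = p then 1 else 0 :=
  Finsupp.single_apply

/-- The coefficient of the trivial path at a vertex. -/
abbrev vertexCoeff (K : Type u) {V : Type v} [Field K] [Quiver.{w} V] (a : V) :
    PathAlgebra K V →ₗ[K] K :=
  coeffHom K ⟨a, a, Quiver.Path.nil⟩

/-- The coefficient of an arrow. -/
abbrev arrowCoeff (K : Type u) {V : Type v} [Field K] [Quiver.{w} V] {a b : V} (f : a ⟶ b) :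
    PathAlgebra K V →ₗ[K] K :=
  coeffHom K ⟨a, b, f.toPath⟩

open Classical in
theorem vertexCoeff_vertexIdem (a b : V) :
    vertexCoeff K a (vertexIdem K b) = if b = a then 1 else 0 := by
  rw [vertexIdem, coeffHom_ofPath]
  exact if_congr ⟨congrArg Sigma.fst, fun h => h ▸ rfl⟩ rfl rfl

theorem vertexCoeff_ofPath_cons (a : V) {b c d : V} (p : Quiver.Path b c) (f : c ⟶ d) :
    vertexCoeff K a (ofPath K (p.cons f)) = 0 := by
  classical
  rw [coeffHom_ofPath, if_neg]
  intro h
  simpa using congrArg (fun r : Quiver.AnyPath V => r.2.2.length) h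

theorem mem_arrowIdeal_iff {x : PathAlgebra K V} :
    x ∈ arrowIdeal K V ↔ ∀ a, vertexCoeff K a x = 0 := by
  constructor
  · intro hx a
    induction hx using Submodule.span_induction with
    | mem x hx =>
      obtain ⟨b, c, p, hp, rfl⟩ := hx
      cases p with
      | nil => exact absurd hp (by simp)
      | cons p f => exact vertexCoeff_ofPath_cons a p f
    | zero => exact map_zero _
    | add x y _ _ hx hy => rw [map_add, hx, hy, add_zero]
    | smul k x _ hx => rw [map_smul, hx, smul_zero]
  · intro hx
    refine Finsupp.sum_single x ▸ Submodule.sum_mem _ fun ⟨a, b, p⟩ hp => ?_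
    cases p with
    | nil => exact absurd (hx a) (Finsupp.mem_support_iff.1 hp)
    | @cons c _ p f =>
      have hpf : coeffHom K ⟨a, b, p.cons f⟩ x • ofPath K (p.cons f) ∈ arrowIdeal K V :=
        Submodule.smul_mem _ _ (Submodule.subset_span ⟨a, b, p.cons f, by simp, rfl⟩)
      exact (Finsupp.smul_single_one (R := K) (⟨a, b, p.cons f⟩ : Quiver.AnyPath V)
        (coeffHom K ⟨a, b, p.cons f⟩ x)) ▸ hpf

theorem arrowCoeff_vertexIdem {a b : V} (f : a ⟶ b) (c : V) :
    arrowCoeff K f (vertexIdem K c) = 0 := by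
  classical
  rw [vertexIdem, coeffHom_ofPath, if_neg]
  intro h
  simpa using congrArg (fun r : Quiver.AnyPath V => r.2.2.length) h

theorem finite_setOf_length_eq [Finite V] [∀ a b : V, Finite (a ⟶ b)] (n : ℕ) :
    {p : Quiver.AnyPath V | p.2.2.length = n}.Finite := by
  induction n with
  | zero =>
    refine (Set.finite_range fun a : V => (⟨a, a, .nil⟩ : Quiver.AnyPath V)).subset ?_
    rintro ⟨a, b, p⟩ hp
    cases p with
    | nil => exact ⟨a, rfl⟩
    | cons p f => simp at hp
  | succ n ih =>
    have := Fintype.ofFinite V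
    refine (ih.biUnion fun q _ => Set.finite_range fun f : Star q.2.1 =>
      (⟨q.1, f.1, q.2.2.cons f.2⟩ : Quiver.AnyPath V)).subset ?_
    rintro ⟨a, b, p⟩ hp
    cases p with
    | nil => simp at hp
    | @cons c _ p f => exact Set.mem_biUnion (x := ⟨a, c, p⟩) (by simpa using hp) ⟨⟨b, f⟩, rfl⟩

theorem anyPath_cons_eq_cons_iff {a b c a' b' c' : V} {p : Quiver.Path a b} {f : b ⟶ c}
    {q : Quiver.Path a' b'} {g : b' ⟶ c'} :
    (⟨a', c', q.cons g⟩ : Quiver.AnyPath V) = ⟨a, c, p.cons f⟩ ↔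
      (⟨b', c', g⟩ : Quiver.Total V) = ⟨b, c, f⟩ ∧
        (⟨a', b', q⟩ : Quiver.AnyPath V) = ⟨a, b, p⟩ := by
  constructor
  · intro h
    cases h
    exact ⟨rfl, rfl⟩
  · rintro ⟨h, h'⟩
    cases h
    cases h'
    rfl

variable [Fintype V]

theorem ofPath_mul_ofPath {a b c : V} (p : Quiver.Path a b) (q : Quiver.Path b c) :
    ofPath K p * ofPath K q = ofPath K (p.comp q) :=
  mulHom_comp p q

theorem ofPath_mul_ofPath_of_ne {a b c d : V} (p : Quiver.Path a b) (q : Quiver.Path c d)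
    (h : b ≠ c) : ofPath K p * ofPath K q = 0 :=
  mulHom_ne p q h

theorem ofPath_cons {a b c : V} (p : Quiver.Path a b) (f : b ⟶ c) :
    ofPath K (p.cons f) = ofPath K p * ofPath K f.toPath :=
  (ofPath_mul_ofPath p f.toPath).symm

open Classical in
theorem coeffHom_mul_vertexIdem (p : Quiver.AnyPath V) (x : PathAlgebra K V) (c : V) :
    coeffHom K p (x * vertexIdem K c) = if p.2.1 = c then coeffHom K p x else 0 := by
  induction x using induction_on with
  | zero => simp
  | add x y hx hy => rw [add_mul, map_add, hx, hy, map_add]; split_ifs <;> simp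
  | @smul k a b q =>
    rw [smul_mul_assoc, map_smul, map_smul, coeffHom_ofPath, vertexIdem]
    obtain rfl | hbc := eq_or_ne b c
    · rw [ofPath_mul_ofPath, Quiver.Path.comp_nil, coeffHom_ofPath]
      split_ifs with h h' <;> aesop
    · rw [ofPath_mul_ofPath_of_ne _ _ hbc]
      split_ifs with h h' <;> aesop

open Classical in
theorem coeffHom_cons_mul_arrow {a b c d d' : V} (p : Quiver.Path a b) (f : b ⟶ c) (g : d ⟶ d')
    (x : PathAlgebra K V) :
    coeffHom K ⟨a, c, p.cons f⟩ (x * ofPath K g.toPath) =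
      if (⟨d, d', g⟩ : Quiver.Total V) = ⟨b, c, f⟩ then coeffHom K ⟨a, b, p⟩ x else 0 := by
  induction x using induction_on with
  | zero => simp
  | add x y hx hy => rw [add_mul, map_add, hx, hy, map_add]; split_ifs <;> simp
  | @smul k a' b' q =>
    rw [smul_mul_assoc, map_smul, map_smul, coeffHom_ofPath]
    obtain rfl | hbd := eq_or_ne b' d
    · rw [← ofPath_cons, coeffHom_ofPath, if_congr anyPath_cons_eq_cons_iff rfl rfl, ite_and,
        smul_ite, smul_zero]
    · rw [ofPath_mul_ofPath_of_ne _ _ hbd]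
      split_ifs with h h' <;> aesop

theorem vertexCoeff_mul_arrow (a : V) {c d : V} (g : c ⟶ d) (x : PathAlgebra K V) :
    vertexCoeff K a (x * ofPath K g.toPath) = 0 := by
  induction x using induction_on with
  | zero => simp
  | add x y hx hy => rw [add_mul, map_add, hx, hy, add_zero]
  | @smul k b b' q =>
    rw [smul_mul_assoc, map_smul]
    obtain rfl | hbd := eq_or_ne b' c
    · rw [← ofPath_cons, vertexCoeff_ofPath_cons, smul_zero]
    · rw [ofPath_mul_ofPath_of_ne _ _ hbd, map_zero, smul_zero]

theorem vertexCoeff_mul (a : V) (x y : PathAlgebra K V) :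
    vertexCoeff K a (x * y) = vertexCoeff K a x * vertexCoeff K a y := by
  classical
  induction y using induction_on with
  | zero => simp
  | add y y' hy hy' => simp only [mul_add, map_add, hy, hy']
  | smul k p =>
    rw [mul_smul_comm, map_smul, map_smul]
    cases p with
    | nil =>
      rw [← vertexIdem, coeffHom_mul_vertexIdem, vertexCoeff_vertexIdem]
      split_ifs <;> simp_all [mul_comm]
    | cons p f =>
      rw [vertexCoeff_ofPath_cons, ofPath_cons, ← mul_assoc, vertexCoeff_mul_arrow, smul_zero,
        mul_zero]

theorem arrowCoeff_mul {a b : V} (f : a ⟶ b) (x y : PathAlgebra K V) :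
    arrowCoeff K f (x * y) =
      vertexCoeff K a x * arrowCoeff K f y + arrowCoeff K f x * vertexCoeff K b y := by
  classical
  induction y using induction_on with
  | zero => simp
  | add y y' hy hy' => simp only [mul_add, map_add, hy, hy']; ring
  | smul k p =>
    rw [mul_smul_comm, map_smul, map_smul, map_smul]
    cases p with
    | nil =>
      rw [← vertexIdem, coeffHom_mul_vertexIdem, vertexCoeff_vertexIdem, arrowCoeff_vertexIdem]
      split_ifs <;> simp_all [mul_comm]
    | cons p g =>
      rw [vertexCoeff_ofPath_cons, ofPath_cons, ← mul_assoc]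
      rw [arrowCoeff, Quiver.Hom.toPath, coeffHom_cons_mul_arrow, coeffHom_cons_mul_arrow]
      split_ifs
      · rw [vertexCoeff_mul, smul_zero, mul_zero, add_zero, smul_eq_mul, smul_eq_mul]; ring
      · simp

theorem vertexCoeff_one (a : V) : vertexCoeff K a (1 : PathAlgebra K V) = 1 := by
  classical
  exact (map_sum _ _ _).trans (by simp [vertexCoeff_vertexIdem])

theorem vertexCoeff_of_mem_arrowIdeal_sq (a : V) {x : PathAlgebra K V}
    (hx : x ∈ arrowIdeal K V ^ 2) : vertexCoeff K a x = 0 := by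
  rw [pow_two] at hx
  induction hx using Submodule.mul_induction_on' with
  | mem_mul_mem x hx y hy => rw [vertexCoeff_mul, mem_arrowIdeal_iff.1 hx, zero_mul]
  | add x _ y _ hx hy => rw [map_add, hx, hy, add_zero]

theorem arrowCoeff_of_mem_arrowIdeal_sq {a b : V} (f : a ⟶ b) {x : PathAlgebra K V}
    (hx : x ∈ arrowIdeal K V ^ 2) : arrowCoeff K f x = 0 := by
  rw [pow_two] at hx
  induction hx using Submodule.mul_induction_on' with
  | mem_mul_mem x hx y hy =>
    rw [arrowCoeff_mul, mem_arrowIdeal_iff.1 hx, mem_arrowIdeal_iff.1 hy, zero_mul, mul_zero,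
      add_zero]
  | add x _ y _ hx hy => rw [map_add, hx, hy, add_zero]

theorem ofPath_mem_arrowIdeal_pow {a b : V} (p : Quiver.Path a b) {n : ℕ} (h : n + 1 ≤ p.length) :
    ofPath K p ∈ arrowIdeal K V ^ (n + 1) := by
  induction n generalizing a b with
  | zero => exact (pow_one (arrowIdeal K V)).symm ▸ Submodule.subset_span ⟨a, b, p, h, rfl⟩
  | succ n ih =>
    cases p with
    | nil => simp at h
    | cons p f =>
      rw [ofPath_cons, pow_succ]
      exact Submodule.mul_mem_mul (ih p (by simpa using h))
        (Submodule.subset_span ⟨_, _, f.toPath, le_rfl, rfl⟩)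

variable [∀ a b : V, Finite (a ⟶ b)]

instance (a : V) : Fintype (Star a) :=
  have := Fintype.ofFinite
  inferInstanceAs (Fintype (Σ b : V, a ⟶ b))

instance (a : V) : Fintype (Costar a) :=
  have := Fintype.ofFinite
  inferInstanceAs (Fintype (Σ b : V, b ⟶ a))

theorem exists_mul_vertexIdem_eq_sum {x : PathAlgebra K V} (hx : x ∈ arrowIdeal K V) (a : V) :
    ∃ q : Costar a → PathAlgebra K V, x * vertexIdem K a = ∑ f, q f * ofPath K f.2.toPath := by
  classical
  induction hx using Submodule.span_induction with
  | mem x hx =>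
    obtain ⟨b, c, p, hp, rfl⟩ := hx
    obtain rfl | hca := eq_or_ne c a
    · cases p with
      | nil => exact absurd hp (by simp)
      | @cons d _ p f =>
        refine ⟨Pi.single ⟨d, f⟩ (ofPath K p), ?_⟩
        rw [Finset.sum_eq_single ⟨d, f⟩ (fun g _ hg => by rw [Pi.single_eq_of_ne hg, zero_mul])
          (by simp), Pi.single_eq_same, ← ofPath_cons]
        exact ofPath_mul_ofPath _ _
    · exact ⟨0, by simp [vertexIdem, ofPath_mul_ofPath_of_ne _ _ hca]⟩
  | zero => exact ⟨0, by simp⟩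
  | add x y _ _ hx hy =>
    obtain ⟨q, hq⟩ := hx
    obtain ⟨r, hr⟩ := hy
    exact ⟨q + r, by simp [add_mul, hq, hr, Finset.sum_add_distrib]⟩
  | smul k x _ hx =>
    obtain ⟨q, hq⟩ := hx
    exact ⟨k • q, by simp [hq, Finset.smul_sum]⟩

theorem exists_vertexIdem_mul_eq_sum {x : PathAlgebra K V} (hx : x ∈ arrowIdeal K V) (a : V) :
    ∃ q : Star a → PathAlgebra K V, vertexIdem K a * x = ∑ f, ofPath K f.2.toPath * q f := by
  classical
  induction hx using Submodule.span_induction with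
  | mem x hx =>
    obtain ⟨b, c, p, hp, rfl⟩ := hx
    obtain rfl | hab := eq_or_ne a b
    · obtain ⟨d, f, p', rfl, -⟩ := (Quiver.Path.length_ne_zero_iff_eq_comp p).1 (by omega)
      refine ⟨Pi.single ⟨d, f⟩ (ofPath K p'), ?_⟩
      rw [Finset.sum_eq_single ⟨d, f⟩ (fun g _ hg => by rw [Pi.single_eq_of_ne hg, mul_zero])
        (by simp), Pi.single_eq_same, ofPath_mul_ofPath, vertexIdem, ofPath_mul_ofPath,
        Quiver.Path.nil_comp]
    · exact ⟨0, by simp [vertexIdem, ofPath_mul_ofPath_of_ne _ _ hab]⟩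
  | zero => exact ⟨0, by simp⟩
  | add x y _ _ hx hy =>
    obtain ⟨q, hq⟩ := hx
    obtain ⟨r, hr⟩ := hy
    exact ⟨q + r, by simp [mul_add, hq, hr, Finset.sum_add_distrib]⟩
  | smul k x _ hx =>
    obtain ⟨q, hq⟩ := hx
    exact ⟨k • q, by simp [hq, Finset.smul_sum]⟩

theorem finiteDimensional_of_surjective {A : Type*} [AddCommGroup A] [Module K A]
    {φ : PathAlgebra K V →ₗ[K] A} (hφ : Function.Surjective φ) {n : ℕ}
    (hn : arrowIdeal K V ^ (n + 1) ≤ LinearMap.ker φ) : FiniteDimensional K A := by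
  have hfin : {p : Quiver.AnyPath V | p.2.2.length < n + 1}.Finite := by
    refine ((Set.finite_lt_nat (n + 1)).biUnion fun k _ => finite_setOf_length_eq k).subset ?_
    exact fun p hp => Set.mem_biUnion hp rfl
  let q (p : Quiver.AnyPath V) : A := φ (ofPath K p.2.2)
  refine Module.finite_def.2 (Submodule.fg_def.2 ⟨_, hfin.image q, top_le_iff.1 fun y _ => ?_⟩)
  obtain ⟨x, rfl⟩ := hφ y
  induction x using induction_on with
  | zero => exact map_zero φ ▸ zero_mem _
  | add x y hx hy => exact map_add φ x y ▸ add_mem (hx trivial) (hy trivial)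
  | @smul k a b p =>
    rw [map_smul]
    refine Submodule.smul_mem _ k ?_
    obtain hp | hp := lt_or_ge p.length (n + 1)
    · exact Submodule.subset_span ⟨⟨a, b, p⟩, hp, rfl⟩
    · exact (LinearMap.mem_ker.1 (hn (ofPath_mem_arrowIdeal_pow p hp))).symm ▸ zero_mem _

end PathAlgebra

end

/-! ### Admissible presentations -/

noncomputable section

open PathAlgebra

/-- An admissible presentation of an algebra `A` by a quiver: a surjection `hom` from the path
algebra onto `A` whose kernel lies between a power and the square of the arrow ideal. -/
structure AdmissiblePresentation (K : Type u) (V : Type v) (A : Type*) [Field K] [Fintype V]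
    [Quiver.{w} V] [Ring A] [Algebra K A] where
  hom : PathAlgebra K V →ₐ[K] A
  surjective : Function.Surjective hom
  exists_pow_le_ker : ∃ n, arrowIdeal K V ^ (n + 1) ≤ LinearMap.ker hom.toLinearMap
  ker_le_sq : LinearMap.ker hom.toLinearMap ≤ arrowIdeal K V ^ 2

namespace AdmissiblePresentation

variable {K : Type u} {V : Type v} {A : Type*} [Field K] [Fintype V] [Quiver.{w} V] [Ring A]
  [Algebra K A] (P : AdmissiblePresentation K V A)

/-- The idempotent of a vertex. -/
def idem (a : V) : A := P.hom (vertexIdem K a)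

/-- The element of the algebra given by an arrow. -/
def arr {a b : V} (f : a ⟶ b) : A := P.hom (ofPath K f.toPath)

/-- The linear form on `A` induced by a linear form on the path algebra which vanishes on the square
of the arrow ideal. -/
def descend (φ : PathAlgebra K V →ₗ[K] K) (hφ : ∀ x ∈ arrowIdeal K V ^ 2, φ x = 0) : A →ₗ[K] K :=
  (exists_comp_eq_of_surjective (p := P.hom.toLinearMap) P.surjective φ
    fun x hx => hφ x (P.ker_le_sq hx)).choose

theorem descend_hom (φ : PathAlgebra K V →ₗ[K] K) (hφ : ∀ x ∈ arrowIdeal K V ^ 2, φ x = 0)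
    (x : PathAlgebra K V) : P.descend φ hφ (P.hom x) = φ x :=
  LinearMap.congr_fun (exists_comp_eq_of_surjective (p := P.hom.toLinearMap) P.surjective φ
    fun x hx => hφ x (P.ker_le_sq hx)).choose_spec x

/-- The character of `A` on the simple module at a vertex: the coefficient of the trivial path. -/
def vertexChar (a : V) : A →ₐ[K] K :=
  AlgHom.ofLinearMap (P.descend (vertexCoeff K a) fun _ => vertexCoeff_of_mem_arrowIdeal_sq a)
    (by rw [← map_one P.hom, descend_hom, vertexCoeff_one])
    fun x y => by
      obtain ⟨x, rfl⟩ := P.surjective x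
      obtain ⟨y, rfl⟩ := P.surjective y
      rw [← map_mul, descend_hom, descend_hom, descend_hom, vertexCoeff_mul]

/-- The coefficient of an arrow, as a linear form on `A`. -/
def arrowForm {a b : V} (f : a ⟶ b) : A →ₗ[K] K :=
  P.descend (arrowCoeff K f) fun _ => arrowCoeff_of_mem_arrowIdeal_sq f

theorem vertexChar_hom (a : V) (x : PathAlgebra K V) :
    P.vertexChar a (P.hom x) = vertexCoeff K a x :=
  P.descend_hom _ _ x

theorem arrowForm_hom {a b : V} (f : a ⟶ b) (x : PathAlgebra K V) :
    P.arrowForm f (P.hom x) = arrowCoeff K f x :=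
  P.descend_hom _ _ x

theorem isIdempotentElem_idem (a : V) : IsIdempotentElem (P.idem a) := by
  rw [IsIdempotentElem, idem, ← map_mul, vertexIdem, ofPath_mul_ofPath, Quiver.Path.comp_nil]

theorem idem_mul_idem_of_ne {a b : V} (h : a ≠ b) : P.idem a * P.idem b = 0 := by
  rw [idem, idem, ← map_mul, vertexIdem, vertexIdem, ofPath_mul_ofPath_of_ne _ _ h, map_zero]

theorem idem_mul_arr {a b : V} (f : a ⟶ b) : P.idem a * P.arr f = P.arr f := by
  rw [idem, arr, ← map_mul, vertexIdem, ofPath_mul_ofPath, Quiver.Path.nil_comp]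

theorem arr_mul_idem {a b : V} (f : a ⟶ b) : P.arr f * P.idem b = P.arr f := by
  rw [idem, arr, ← map_mul, vertexIdem, ofPath_mul_ofPath, Quiver.Path.comp_nil]

theorem vertexChar_idem_self (a : V) : P.vertexChar a (P.idem a) = 1 := by
  classical
  rw [idem, vertexChar_hom, vertexCoeff_vertexIdem, if_pos rfl]

theorem vertexChar_idem_of_ne {a b : V} (h : b ≠ a) : P.vertexChar a (P.idem b) = 0 := by
  classical
  rw [idem, vertexChar_hom, vertexCoeff_vertexIdem, if_neg h]

theorem vertexChar_arr (c : V) {a b : V} (f : a ⟶ b) : P.vertexChar c (P.arr f) = 0 := by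
  rw [arr, vertexChar_hom]
  exact vertexCoeff_ofPath_cons c .nil f

theorem arrowForm_idem {a b : V} (f : a ⟶ b) (c : V) : P.arrowForm f (P.idem c) = 0 := by
  rw [idem, arrowForm_hom, arrowCoeff_vertexIdem]

theorem arrowForm_mul {a b : V} (f : a ⟶ b) (x y : A) :
    P.arrowForm f (x * y) =
      P.vertexChar a x * P.arrowForm f y + P.arrowForm f x * P.vertexChar b y := by
  obtain ⟨x, rfl⟩ := P.surjective x
  obtain ⟨y, rfl⟩ := P.surjective y
  simp only [← map_mul, arrowForm_hom, vertexChar_hom, arrowCoeff_mul]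

theorem arrowForm_arr_self {a b : V} (f : a ⟶ b) : P.arrowForm f (P.arr f) = 1 := by
  classical
  rw [arr, arrowForm_hom, coeffHom_ofPath, if_pos rfl]

theorem arrowForm_arr_of_ne {a b c d : V} {f : a ⟶ b} {g : c ⟶ d}
    (h : (⟨c, d, g⟩ : Quiver.Total V) ≠ ⟨a, b, f⟩) : P.arrowForm f (P.arr g) = 0 := by
  classical
  rw [arr, arrowForm_hom, coeffHom_ofPath, if_neg]
  exact fun h' => h (anyPath_cons_eq_cons_iff.1 h').1

/-- The radical of `A`, as a subspace: the image of the arrow ideal. -/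
def rad : Submodule K A := (arrowIdeal K V).map P.hom.toLinearMap

theorem mem_rad_iff {x : A} : x ∈ P.rad ↔ ∀ a, P.vertexChar a x = 0 := by
  constructor
  · rintro ⟨x, hx, rfl⟩ a
    exact (P.vertexChar_hom a x).trans (mem_arrowIdeal_iff.1 hx a)
  · obtain ⟨x, rfl⟩ := P.surjective x
    exact fun hx => ⟨x, mem_arrowIdeal_iff.2 fun a => P.vertexChar_hom a x ▸ hx a, rfl⟩

theorem mul_mem_rad_left (x : A) {y : A} (hy : y ∈ P.rad) : x * y ∈ P.rad :=
  P.mem_rad_iff.2 fun a => by rw [map_mul, P.mem_rad_iff.1 hy, mul_zero]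

theorem mul_mem_rad_right {x : A} (hx : x ∈ P.rad) (y : A) : x * y ∈ P.rad :=
  P.mem_rad_iff.2 fun a => by rw [map_mul, P.mem_rad_iff.1 hx, zero_mul]

theorem arr_mem_rad {a b : V} (f : a ⟶ b) : P.arr f ∈ P.rad :=
  P.mem_rad_iff.2 fun c => P.vertexChar_arr c f

theorem isNilpotent_rad : IsNilpotent P.rad := by
  obtain ⟨n, hn⟩ := P.exists_pow_le_ker
  refine ⟨n + 1, ?_⟩
  rw [rad, ← Submodule.map_pow]
  exact LinearMap.le_ker_iff_map.1 hn

theorem mem_jacobson_of_mem_rad {x : A} (hx : x ∈ P.rad) : x ∈ Ring.jacobson A := by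
  rw [← Ideal.jacobson_bot, Ideal.mem_jacobson_iff]
  intro y
  have hnil : IsNilpotent (y * x) := by
    obtain ⟨n, hn⟩ := P.isNilpotent_rad
    exact ⟨n, by simpa [hn] using Submodule.pow_mem_pow _ (P.mul_mem_rad_left y hx) n⟩
  obtain ⟨z, hz⟩ := hnil.isUnit_one_add.exists_left_inv
  exact ⟨z, (Ideal.mem_bot).2 (by rw [mul_assoc, ← hz]; noncomm_ring)⟩

theorem span_idem_sup_rad :
    Submodule.span K (Set.range P.idem) ⊔ P.rad = ⊤ := by
  classical
  refine top_le_iff.1 fun x _ => ?_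
  have hx : x - ∑ c, P.vertexChar c x • P.idem c ∈ P.rad := P.mem_rad_iff.2 fun a => by
    rw [map_sub, map_sum, Finset.sum_eq_single a
      (fun c _ hc => by rw [map_smul, P.vertexChar_idem_of_ne hc, smul_zero]) (by simp), map_smul,
      P.vertexChar_idem_self, smul_eq_mul, mul_one, sub_self]
  exact Submodule.mem_sup.2 ⟨_, Submodule.sum_mem _ fun c _ => Submodule.smul_mem _ _
    (Submodule.subset_span ⟨c, rfl⟩), _, hx, add_sub_cancel _ _⟩

theorem vertexChar_eq_zero_of_mul_idem {x : A} {a c : V} (hx : x * P.idem a = x) (h : a ≠ c) :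
    P.vertexChar c x = 0 := by
  rw [← hx, map_mul, P.vertexChar_idem_of_ne h, mul_zero]

theorem vertexChar_eq_zero_of_idem_mul {x : A} {a c : V} (hx : P.idem a * x = x) (h : a ≠ c) :
    P.vertexChar c x = 0 := by
  rw [← hx, map_mul, P.vertexChar_idem_of_ne h, zero_mul]

theorem sub_smul_idem_mem_rad {x : A} {a : V} (hx : ∀ c, a ≠ c → P.vertexChar c x = 0) :
    x - P.vertexChar a x • P.idem a ∈ P.rad := by
  refine P.mem_rad_iff.2 fun c => ?_
  obtain rfl | hac := eq_or_ne a c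
  · rw [map_sub, map_smul, P.vertexChar_idem_self, smul_eq_mul, mul_one, sub_self]
  · rw [map_sub, map_smul, P.vertexChar_idem_of_ne hac, hx c hac, smul_zero, sub_zero]

variable [∀ a b : V, Finite (a ⟶ b)]

theorem finiteDimensional (P : AdmissiblePresentation K V A) : FiniteDimensional K A :=
  have ⟨_, hn⟩ := P.exists_pow_le_ker
  finiteDimensional_of_surjective (φ := P.hom.toLinearMap) P.surjective hn

theorem exists_eq_sum_mul_arr {x : A} (hx : x ∈ P.rad) {a : V} (hxa : x * P.idem a = x) :
    ∃ q : Costar a → A, (∀ f, q f * P.idem f.1 = q f) ∧ x = ∑ f, q f * P.arr f.2 := by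
  obtain ⟨x, hx, rfl⟩ := hx
  obtain ⟨q, hq⟩ := exists_mul_vertexIdem_eq_sum hx a
  refine ⟨fun f => P.hom (q f) * P.idem f.1, fun f => ?_, ?_⟩
  · rw [mul_assoc, P.isIdempotentElem_idem]
  · rw [← hxa]
    simp only [mul_assoc, idem_mul_arr]
    refine (map_mul P.hom x _).symm.trans ?_
    rw [hq, map_sum]
    exact Finset.sum_congr rfl fun f _ => map_mul ..

theorem exists_eq_sum_arr_mul {x : A} (hx : x ∈ P.rad) {a : V} (hxa : P.idem a * x = x) :
    ∃ q : Star a → A, (∀ f, P.idem f.1 * q f = q f) ∧ x = ∑ f, P.arr f.2 * q f := by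
  obtain ⟨x, hx, rfl⟩ := hx
  obtain ⟨q, hq⟩ := exists_vertexIdem_mul_eq_sum hx a
  refine ⟨fun f => P.idem f.1 * P.hom (q f), fun f => ?_, ?_⟩
  · rw [← mul_assoc, P.isIdempotentElem_idem]
  · rw [← hxa]
    simp only [← mul_assoc, arr_mul_idem]
    refine (map_mul P.hom _ x).symm.trans ?_
    rw [hq, map_sum]
    exact Finset.sum_congr rfl fun f _ => map_mul ..

theorem arrowForm_sum_mul_arr {a : V} (q : Costar a → A) (f : Costar a) :
    P.arrowForm f.2 (∑ g, q g * P.arr g.2) = P.vertexChar f.1 (q f) := by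
  rw [map_sum, Finset.sum_eq_single f (fun g _ hg => ?_) (by simp), arrowForm_mul,
    arrowForm_arr_self, vertexChar_arr, mul_one, mul_zero, add_zero]
  rw [arrowForm_mul, vertexChar_arr, mul_zero, add_zero, arrowForm_arr_of_ne, mul_zero]
  obtain ⟨c, f⟩ := f
  obtain ⟨d, g⟩ := g
  rintro ⟨⟩
  exact hg rfl

theorem arrowForm_sum_arr_mul {a : V} (q : Star a → A) (f : Star a) :
    P.arrowForm f.2 (∑ g, P.arr g.2 * q g) = P.vertexChar f.1 (q f) := by
  rw [map_sum, Finset.sum_eq_single f (fun g _ hg => ?_) (by simp), arrowForm_mul,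
    arrowForm_arr_self, vertexChar_arr, one_mul, zero_mul, zero_add]
  rw [arrowForm_mul, vertexChar_arr, zero_mul, zero_add, arrowForm_arr_of_ne, zero_mul]
  obtain ⟨c, f⟩ := f
  obtain ⟨d, g⟩ := g
  rintro ⟨⟩
  exact hg rfl

theorem sub_sum_costar_mem_rad_mul_rad {x : A} (hx : x ∈ P.rad) {a : V} (hxa : x * P.idem a = x) :
    x - ∑ f : Costar a, P.arrowForm f.2 x • P.arr f.2 ∈ P.rad * P.rad := by
  obtain ⟨q, hq, hxq⟩ := P.exists_eq_sum_mul_arr hx hxa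
  have hsum : x - ∑ f : Costar a, P.arrowForm f.2 x • P.arr f.2 =
      ∑ f, (q f - P.vertexChar f.1 (q f) • P.idem f.1) * P.arr f.2 := by
    simp only [sub_mul, smul_mul_assoc, idem_mul_arr, Finset.sum_sub_distrib, ← hxq]
    simp only [hxq, arrowForm_sum_mul_arr]
  rw [hsum]
  exact Submodule.sum_mem _ fun f _ => Submodule.mul_mem_mul
    (P.sub_smul_idem_mem_rad fun _ => P.vertexChar_eq_zero_of_mul_idem (hq f)) (P.arr_mem_rad f.2)

theorem sub_sum_star_mem_rad_mul_rad {x : A} (hx : x ∈ P.rad) {a : V} (hxa : P.idem a * x = x) :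
    x - ∑ f : Star a, P.arrowForm f.2 x • P.arr f.2 ∈ P.rad * P.rad := by
  obtain ⟨q, hq, hxq⟩ := P.exists_eq_sum_arr_mul hx hxa
  have hsum : x - ∑ f : Star a, P.arrowForm f.2 x • P.arr f.2 =
      ∑ f, P.arr f.2 * (q f - P.vertexChar f.1 (q f) • P.idem f.1) := by
    simp only [mul_sub, mul_smul_comm, arr_mul_idem, Finset.sum_sub_distrib, ← hxq]
    simp only [hxq, arrowForm_sum_arr_mul]
  rw [hsum]
  exact Submodule.sum_mem _ fun f _ => Submodule.mul_mem_mul (P.arr_mem_rad f.2)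
    (P.sub_smul_idem_mem_rad fun _ => P.vertexChar_eq_zero_of_idem_mul (hq f))

end AdmissiblePresentation

/-- The presentation of the quotient of the path algebra by an admissible ideal. -/
def PathAlgebra.IsAdmissible.presentation {K : Type u} {V : Type v} [Field K] [Fintype V]
    [Quiver.{w} V] {I : Ideal (PathAlgebra K V)} [I.IsTwoSided] (hI : IsAdmissible I) :
    AdmissiblePresentation K V (PathAlgebra K V ⧸ I) where
  hom := Ideal.Quotient.mkₐ K I
  surjective := Ideal.Quotient.mk_surjective
  exists_pow_le_ker :=
    have ⟨m, hm, hmI, _⟩ := hI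
    ⟨m - 1, fun _ hx => Ideal.Quotient.eq_zero_iff_mem.2
      (hmI (by rwa [Nat.sub_add_cancel (by omega)] at hx))⟩
  ker_le_sq _ hx :=
    have ⟨_, _, _, hI₂⟩ := hI
    hI₂ (Ideal.Quotient.eq_zero_iff_mem.1 hx)

end

/-! ### Second syzygies of simple modules -/

noncomputable section

namespace AdmissiblePresentation

variable {K : Type u} {V : Type v} {A : Type*} [Field K] [Fintype V] [Quiver.{w} V] [Ring A]
  [Algebra K A] (P : AdmissiblePresentation K V A)

/-- The projective left module `A e` at a vertex. -/
def proj (a : V) : Submodule A A :=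
  LinearMap.eqLocus (LinearMap.toSpanSingleton A A (P.idem a)) LinearMap.id

theorem mul_idem_of_proj {a : V} (x : P.proj a) : (x : A) * P.idem a = x :=
  x.2

/-- The generator of the projective module at a vertex. -/
def projGen (a : V) : P.proj a :=
  ⟨P.idem a, P.isIdempotentElem_idem a⟩

theorem smul_projGen {a : V} (x : P.proj a) : (x : A) • P.projGen a = x :=
  Subtype.ext x.2

/-- The projection of `A` onto the projective module at a vertex. -/
def toProj (a : V) : A →ₗ[A] P.proj a :=
  LinearMap.toSpanSingleton A (P.proj a) (P.projGen a)

theorem toProj_coe {a : V} (x : P.proj a) : P.toProj a x = x :=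
  P.smul_projGen x

instance (a : V) : Module.Projective A (P.proj a) :=
  .of_split (P.proj a).subtype (P.toProj a) (LinearMap.ext P.toProj_coe)

instance (a : V) : Module.Finite A (P.proj a) :=
  .of_surjective (P.toProj a) fun x => ⟨x, P.toProj_coe x⟩

instance {ι : Type*} [Finite ι] (a : ι → V) : Module.Projective A (∀ i, P.proj (a i)) := by
  classical
  have := Fintype.ofFinite ι
  exact .of_equiv (DFinsupp.linearEquivFunOnFintype (R := A) (M := fun i => P.proj (a i)))

theorem sum_smul_single {ι : Type*} [Fintype ι] [DecidableEq ι] {a : ι → V}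
    (x : ∀ i, P.proj (a i)) : ∑ i, (x i : A) • Pi.single i (P.projGen (a i)) = x := by
  simp only [← Pi.single_smul, smul_projGen]
  exact Finset.univ_sum_single x

/-- Right multiplication by an arrow. -/
def mulArr {a b : V} (f : a ⟶ b) : P.proj a →ₗ[A] P.proj b :=
  (LinearMap.toSpanSingleton A (P.proj b) ⟨P.arr f, P.arr_mul_idem f⟩) ∘ₗ (P.proj a).subtype

theorem coe_mulArr {a b : V} (f : a ⟶ b) (x : P.proj a) : (P.mulArr f x : A) = x * P.arr f :=
  rfl

theorem mem_rad_of_proj {a : V} (x : P.proj a) (hx : P.vertexChar a x = 0) : (x : A) ∈ P.rad :=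
  P.mem_rad_iff.2 fun c => by
    obtain rfl | hac := eq_or_ne a c
    · exact hx
    · exact P.vertexChar_eq_zero_of_mul_idem x.2 hac

/-- The projection from the projective module at a vertex onto the simple module. -/
def projToSimple (a : V) : P.proj a →ₗ[A] A ⧸ RingHom.ker (P.vertexChar a) :=
  (RingHom.ker (P.vertexChar a)).mkQ ∘ₗ (P.proj a).subtype

theorem projToSimple_surjective (a : V) : Function.Surjective (P.projToSimple a) := by
  intro y
  obtain ⟨x, rfl⟩ := Submodule.Quotient.mk_surjective _ y
  refine ⟨P.toProj a x, (Submodule.Quotient.eq _).2 ?_⟩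
  change P.vertexChar a (x * P.idem a - x) = 0
  rw [map_sub, map_mul, P.vertexChar_idem_self, mul_one, sub_self]

theorem projToSimple_eq_zero_iff {a : V} (x : P.proj a) :
    P.projToSimple a x = 0 ↔ P.vertexChar a x = 0 :=
  Submodule.Quotient.mk_eq_zero _

variable [∀ a b : V, Finite (a ⟶ b)]

/-- The presentation of the radical of the projective module at `a` by the arrows which end at
`a`. -/
def sumMulArr (a : V) : (∀ f : Costar a, P.proj f.1) →ₗ[A] P.proj a :=
  ∑ f : Costar a, P.mulArr f.2 ∘ₗ LinearMap.proj f

theorem coe_sumMulArr {a : V} (q : ∀ f : Costar a, P.proj f.1) :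
    (P.sumMulArr a q : A) = ∑ f, q f * P.arr f.2 := by
  simp [sumMulArr, coe_mulArr]

/-- The relations between the arrows which end at `a`: the second syzygy of the simple module
at `a`. -/
def relations (a : V) : Submodule A (∀ f : Costar a, P.proj f.1) :=
  LinearMap.ker (P.sumMulArr a)

theorem mem_relations_iff {a : V} {q : ∀ f : Costar a, P.proj f.1} :
    q ∈ P.relations a ↔ ∑ f, (q f : A) * P.arr f.2 = 0 := by
  rw [relations, LinearMap.mem_ker, Subtype.ext_iff, coe_sumMulArr, ZeroMemClass.coe_zero]

theorem mem_rad_of_mem_relations {a : V} {q : ∀ f : Costar a, P.proj f.1}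
    (hq : q ∈ P.relations a) (f : Costar a) : (q f : A) ∈ P.rad :=
  P.mem_rad_of_proj _ <| by
    rw [← P.arrowForm_sum_mul_arr (fun g => (q g : A)), P.mem_relations_iff.1 hq, map_zero]

theorem relations_le_jacobson (a : V) :
    P.relations a ≤ Module.jacobson A (∀ f : Costar a, P.proj f.1) := by
  classical
  refine fun q hq => Ring.jacobson_smul_top_le A _ ?_
  rw [← P.sum_smul_single q]
  exact Submodule.sum_mem _ fun f _ => Submodule.smul_mem_smul
    (P.mem_jacobson_of_mem_rad (P.mem_rad_of_mem_relations hq f)) trivial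

theorem exact_sumMulArr_projToSimple (a : V) :
    Function.Exact (P.sumMulArr a) (P.projToSimple a) := by
  intro x
  rw [projToSimple_eq_zero_iff]
  constructor
  · intro hx
    obtain ⟨q, hq, hxq⟩ := P.exists_eq_sum_mul_arr (P.mem_rad_of_proj x hx) x.2
    exact ⟨fun f => ⟨q f, hq f⟩, Subtype.ext ((P.coe_sumMulArr _).trans hxq.symm)⟩
  · rintro ⟨q, rfl⟩
    rw [coe_sumMulArr, map_sum]
    exact Finset.sum_eq_zero fun f _ => by rw [map_mul, vertexChar_arr, mul_zero]

/-- Right multiplication by the arrows which start at `a`. -/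
def piMulArr (a : V) : P.proj a →ₗ[A] ∀ g : Star a, P.proj g.1 :=
  LinearMap.pi fun g => P.mulArr g.2

theorem piMulArr_eq_zero_iff {a : V} (p : P.proj a) :
    P.piMulArr a p = 0 ↔ ∀ x, (p : A) * x = P.vertexChar a x • (p : A) := by
  constructor
  · intro hp x
    have hp' (g : Star a) : (p : A) * P.arr g.2 = 0 :=
      congrArg Subtype.val (congrFun hp g)
    have hxr : P.idem a * x - P.vertexChar a x • P.idem a ∈ P.rad := by
      have := P.sub_smul_idem_mem_rad (x := P.idem a * x) (a := a) fun c hc => by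
        rw [map_mul, P.vertexChar_idem_of_ne hc, zero_mul]
      rwa [map_mul, P.vertexChar_idem_self, one_mul] at this
    obtain ⟨q, -, hq⟩ := P.exists_eq_sum_arr_mul hxr (a := a) <| by
      rw [mul_sub, ← mul_assoc, mul_smul_comm, P.isIdempotentElem_idem]
    have hpx : (p : A) * x - P.vertexChar a x • (p : A) =
        p * (P.idem a * x - P.vertexChar a x • P.idem a) := by
      rw [mul_sub, ← mul_assoc, mul_smul_comm, mul_idem_of_proj]
    rw [← sub_eq_zero, hpx, hq, Finset.mul_sum]
    exact Finset.sum_eq_zero fun g _ => by rw [← mul_assoc, hp', zero_mul]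
  · intro hp
    refine funext fun g => Subtype.ext ?_
    change (p : A) * P.arr g.2 = 0
    rw [hp, vertexChar_arr, zero_smul]

/-- A family of relations at `a`, indexed by the arrows which start at `a`, which exhibits the
second syzygy of the simple module at `a` as its second cosyzygy: it generates the relations and is
itself subject to the dual relation. -/
structure IsRelationMatrix {a : V} (φ : Star a → P.relations a) : Prop where
  idem_smul : ∀ g, P.idem g.1 • φ g = φ g
  sum_arr_smul : ∑ g, P.arr g.2 • φ g = 0
  exists_eq_sum : ∀ q, ∃ r : Star a → A, q = ∑ g, r g • φ g

variable {A : Type (max u v w)} [Ring A] [Algebra K A] (P : AdmissiblePresentation K V A)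

theorem isWeakSecondSyzygy_relations (a : V) :
    IsWeakSecondSyzygy A (A ⧸ RingHom.ker (P.vertexChar a)) (P.relations a) :=
  .of_exact (P.relations a).subtype_injective
    (fun x => by rw [relations, ← LinearMap.mem_ker]; simp)
    (P.exact_sumMulArr_projToSimple a) (P.projToSimple_surjective a)

theorem isWeakSecondSyzygy_cokernel (hsymm : IsSymmAlgebra K A) (a : V) :
    IsWeakSecondSyzygy A ((∀ g : Star a, P.proj g.1) ⧸ LinearMap.range (P.piMulArr a))
      (A ⧸ RingHom.ker (P.vertexChar a)) := by
  have := P.finiteDimensional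
  obtain ⟨z, hz, hlz, hrz, hzp⟩ := hsymm.exists_socle (P.vertexChar a)
  have hza : z * P.idem a = z := by rw [hrz, vertexChar_idem_self, one_smul]
  let z' : P.proj a := ⟨z, hza⟩
  let i : (A ⧸ RingHom.ker (P.vertexChar a)) →ₗ[A] P.proj a :=
    (RingHom.ker (P.vertexChar a)).liftQ (LinearMap.toSpanSingleton A _ z') fun x hx =>
      Subtype.ext ((hlz x).trans (by rw [RingHom.mem_ker.1 hx, zero_smul]; rfl))
  have hi (x : A) : (i (Submodule.Quotient.mk x) : A) = P.vertexChar a x • z := hlz x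
  refine .of_exact (i := i) (d := P.piMulArr a) (p := (LinearMap.range (P.piMulArr a)).mkQ)
    ?_ ?_ (LinearMap.exact_map_mkQ_range _) (Submodule.mkQ_surjective _)
  · refine (injective_iff_map_eq_zero i).2 fun y hy => ?_
    obtain ⟨x, rfl⟩ := Submodule.Quotient.mk_surjective _ y
    have hxz := (hi x).symm.trans (congrArg Subtype.val hy)
    exact (Submodule.Quotient.mk_eq_zero _).2 ((smul_eq_zero.1 hxz).resolve_right hz)
  · intro p
    rw [piMulArr_eq_zero_iff]
    constructor
    · intro hp
      obtain ⟨c, hc⟩ := hzp p hp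
      refine ⟨Submodule.Quotient.mk (algebraMap K A c), Subtype.ext ?_⟩
      rw [hi, AlgHom.commutes, hc]; rfl
    · rintro ⟨y, rfl⟩ x
      obtain ⟨y, rfl⟩ := Submodule.Quotient.mk_surjective _ y
      rw [hi, smul_mul_assoc, hrz, smul_comm]

theorem exists_isRelationMatrix (hsymm : IsSymmAlgebra K A)
    (hper : IsIteratedSyzygy 4 (regularBimodule K A) (regularBimodule K A)) (a : V) :
    ∃ φ : Star a → P.relations a, P.IsRelationMatrix φ := by
  classical
  have := P.finiteDimensional
  have := IsNoetherianRing.of_finite K A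
  -- The period gives `Ω⁴ S ≅ S` for the simple module `S` at `a`, hence `Ω² S ≅ Ω⁻² S`.
  obtain ⟨G, hG⟩ := (hper.isStableRetract hsymm.baer _ (P.isWeakSecondSyzygy_relations a)
    (P.isWeakSecondSyzygy_cokernel hsymm a)).exists_surjective hsymm.baer
    (P.relations a).subtype_injective
    ((P.relations a).range_subtype.trans_le (P.relations_le_jacobson a))
  let F := G ∘ₗ (LinearMap.range (P.piMulArr a)).mkQ
  let ε (g : Star a) : ∀ g : Star a, P.proj g.1 := Pi.single g (P.projGen g.1)
  refine ⟨fun g => F (ε g), fun g => ?_, ?_, fun q => ?_⟩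
  · rw [← map_smul, ← Pi.single_smul]
    exact congrArg (fun x => F (Pi.single g x)) (P.smul_projGen (P.projGen g.1))
  · have hε : ∑ g, P.arr g.2 • ε g = P.piMulArr a (P.projGen a) := by
      rw [← P.sum_smul_single (P.piMulArr a _)]
      exact Finset.sum_congr rfl fun g _ => congrArg (· • ε g) (P.idem_mul_arr g.2).symm
    simp only [← map_smul, ← map_sum, hε]
    exact (congrArg G ((Submodule.Quotient.mk_eq_zero _).2 ⟨_, rfl⟩)).trans (map_zero G)
  · obtain ⟨x, rfl⟩ := (hG.comp (Submodule.mkQ_surjective _)) q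
    refine ⟨fun g => x g, ?_⟩
    simp only [← map_smul, ← map_sum]
    exact congrArg F (P.sum_smul_single x).symm

end AdmissiblePresentation

end

/-! ### Relations of length two -/

noncomputable section

namespace AdmissiblePresentation

variable {K : Type u} {V : Type v} {A : Type*} [Field K] [Fintype V] [Quiver.{w} V] [Ring A]
  [Algebra K A] (P : AdmissiblePresentation K V A)

theorem arrowForm_eq_zero_of_idem_mul {x : A} {a b c : V} (f : a ⟶ b) (hx : P.idem c * x = x)
    (h : c ≠ a) : P.arrowForm f x = 0 := by
  rw [← hx, arrowForm_mul, P.vertexChar_idem_of_ne h, arrowForm_idem, zero_mul, zero_mul, add_zero]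

theorem arrowForm_eq_zero_of_mul_idem {x : A} {a b c : V} (f : a ⟶ b) (hx : x * P.idem c = x)
    (h : c ≠ b) : P.arrowForm f x = 0 := by
  rw [← hx, arrowForm_mul, P.vertexChar_idem_of_ne h, arrowForm_idem, mul_zero, mul_zero, add_zero]

theorem not_rad_annihilates_arr (hsymm : IsSymmAlgebra K A) {a b : V} (f : a ⟶ b)
    (hab : a ≠ b) :
    ¬ ((∀ y ∈ P.rad, P.arr f * y = 0) ∨ ∀ y ∈ P.rad, y * P.arr f = 0) := by
  intro h
  have hf : P.arr f = 0 := hsymm.eq_zero_of_forall_mul_eq_zero P.isIdempotentElem_idem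
    P.span_idem_sup_rad (fun c => ?_) fun y hy => h.imp (· y hy) (· y hy)
  · exact one_ne_zero (α := K) (by rw [← P.arrowForm_arr_self f, hf, map_zero])
  · obtain rfl | hca := eq_or_ne c a
    · rw [idem_mul_arr, ← P.arr_mul_idem, mul_assoc, P.idem_mul_idem_of_ne hab.symm, mul_zero]
    · rw [← P.idem_mul_arr, ← mul_assoc, P.idem_mul_idem_of_ne hca, zero_mul, zero_mul]

variable [∀ a b : V, Finite (a ⟶ b)]

/-- The coefficient of an arrow in a relation. -/
def relCoeff {a : V} (f : Costar a) : P.relations a →ₗ[A] A :=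
  (P.proj f.1).subtype ∘ₗ LinearMap.proj f ∘ₗ (P.relations a).subtype

theorem relCoeff_mul_idem {a : V} (f : Costar a) (q : P.relations a) :
    P.relCoeff f q * P.idem f.1 = P.relCoeff f q :=
  P.mul_idem_of_proj (q.1 f)

theorem relCoeff_mem_rad {a : V} (f : Costar a) (q : P.relations a) : P.relCoeff f q ∈ P.rad :=
  P.mem_rad_of_mem_relations q.2 f

theorem sum_relCoeff_mul_arr {a : V} (q : P.relations a) :
    ∑ f, P.relCoeff f q * P.arr f.2 = 0 :=
  P.mem_relations_iff.1 q.2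

theorem exists_relCoeff_eq {a : V} {q : Costar a → A} (hq : ∀ f, q f * P.idem f.1 = q f)
    (hq0 : ∑ f, q f * P.arr f.2 = 0) : ∃ x : P.relations a, ∀ f, P.relCoeff f x = q f :=
  ⟨⟨fun f => ⟨q f, hq f⟩, P.mem_relations_iff.2 hq0⟩, fun _ => rfl⟩

theorem arrowForm_mul_relCoeff {a b c : V} (α : a ⟶ b) (f : Costar c) (x : A)
    (q : P.relations c) :
    P.arrowForm α (x * P.relCoeff f q) = P.vertexChar a x * P.arrowForm α (P.relCoeff f q) := by
  rw [arrowForm_mul, P.mem_rad_iff.1 (P.relCoeff_mem_rad f q), mul_zero, add_zero]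

/-- The path `αβ` occurs in a relation of the presentation. -/
def Occurs {a b c : V} (α : a ⟶ b) (β : b ⟶ c) : Prop :=
  ∃ q : P.relations c, P.arrowForm α (P.relCoeff ⟨b, β⟩ q) ≠ 0

theorem IsRelationMatrix.exists_arrow {P : AdmissiblePresentation K V A} {i j k : V} {α : k ⟶ i}
    {β : i ⟶ j} {φ : Star j → P.relations j} (hφ : P.IsRelationMatrix φ) (h : P.Occurs α β) :
    ∃ δ : j ⟶ k, P.arrowForm α (P.relCoeff ⟨i, β⟩ (φ ⟨k, δ⟩)) ≠ 0 := by
  obtain ⟨q, hq⟩ := h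
  obtain ⟨r, rfl⟩ := hφ.exists_eq_sum q
  rw [map_sum, map_sum] at hq
  obtain ⟨⟨k', δ⟩, -, hδ⟩ := Finset.exists_ne_zero_of_sum_ne_zero hq
  rw [map_smul, smul_eq_mul, arrowForm_mul_relCoeff] at hδ
  have hφδ := right_ne_zero_of_mul hδ
  obtain rfl : k' = k := by
    contrapose! hφδ
    refine P.arrowForm_eq_zero_of_idem_mul α ?_ hφδ
    exact ((P.relCoeff _).map_smul _ _).symm.trans
      (congrArg (P.relCoeff _) (hφ.idem_smul ⟨k', δ⟩))
  exact ⟨δ, hφδ⟩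

/- Write the entries `φ_δ` in the column of `β` as combinations of the arrows which end at `i`; the
dual relation `∑ δ, δ φ_δ = 0` then becomes a relation at `i`. -/
theorem IsRelationMatrix.exists_transpose {P : AdmissiblePresentation K V A} {i j : V}
    (β : i ⟶ j) {φ : Star j → P.relations j} (hφ : P.IsRelationMatrix φ) :
    ∃ s : P.relations i, P.idem j • s = s ∧ ∀ (k : V) (α : k ⟶ i) (δ : j ⟶ k),
      P.arrowForm δ (P.relCoeff ⟨k, α⟩ s) = P.arrowForm α (P.relCoeff ⟨i, β⟩ (φ ⟨k, δ⟩)) := by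
  choose r hri hr using fun g => P.exists_eq_sum_mul_arr (P.relCoeff_mem_rad ⟨i, β⟩ (φ g))
    (P.relCoeff_mul_idem ⟨i, β⟩ (φ g))
  obtain ⟨s, hs⟩ := P.exists_relCoeff_eq (q := fun f => ∑ g, P.arr g.2 * r g f)
    (fun f => by simp only [Finset.sum_mul, mul_assoc, hri]) <| by
      have hdual := congrArg (P.relCoeff ⟨i, β⟩) hφ.sum_arr_smul
      simp only [map_sum, map_smul, map_zero, smul_eq_mul, hr, Finset.mul_sum] at hdual
      rw [Finset.sum_comm] at hdual
      simpa only [Finset.sum_mul, mul_assoc] using hdual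
  refine ⟨s, Subtype.ext <| funext fun f => Subtype.ext ?_, fun k α δ => ?_⟩
  · change P.idem j * P.relCoeff f s = P.relCoeff f s
    simp only [hs, Finset.mul_sum, ← mul_assoc, idem_mul_arr]
  · rw [hs, hr]
    exact (P.arrowForm_sum_arr_mul (fun g => r g ⟨k, α⟩) ⟨k, δ⟩).trans
      (P.arrowForm_sum_mul_arr (r ⟨k, δ⟩) ⟨k, α⟩).symm

theorem Occurs.exists_relation {P : AdmissiblePresentation K V A} {i j k : V} {α : k ⟶ i}
    {β : i ⟶ j} (h : P.Occurs α β) {φ : Star j → P.relations j} (hφ : P.IsRelationMatrix φ) :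
    ∃ (δ : j ⟶ k) (s : P.relations i), P.idem j • s = s ∧
      P.arrowForm δ (P.relCoeff ⟨k, α⟩ s) ≠ 0 := by
  obtain ⟨δ, hδ⟩ := hφ.exists_arrow h
  obtain ⟨s, hjs, hs⟩ := hφ.exists_transpose β
  exact ⟨δ, s, hjs, (hs k α δ).trans_ne hδ⟩

theorem Occurs.exists_mul_arr_eq_zero {P : AdmissiblePresentation K V A} {i j k : V} {α : k ⟶ i}
    {β : i ⟶ j} (h : P.Occurs α β) {φ : Star j → P.relations j} (hφ : P.IsRelationMatrix φ)
    [Subsingleton (Costar i)] :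
    ∃ δ : j ⟶ k, ∃ w ∈ P.rad, w * P.arr α = 0 ∧ P.idem j * w = w ∧ w * P.idem k = w ∧
      P.arrowForm δ w ≠ 0 := by
  obtain ⟨δ, s, hjs, hs⟩ := h.exists_relation hφ
  have hsum := P.sum_relCoeff_mul_arr s
  rw [Fintype.sum_subsingleton _ ⟨k, α⟩] at hsum
  exact ⟨δ, P.relCoeff ⟨k, α⟩ s, P.relCoeff_mem_rad _ s, hsum,
    ((P.relCoeff _).map_smul _ s).symm.trans (congrArg _ hjs), P.relCoeff_mul_idem _ s, hs⟩

theorem Occurs.exists_arr_mul_eq_zero {P : AdmissiblePresentation K V A} {i j k : V} {α : k ⟶ i}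
    {β : i ⟶ j} (h : P.Occurs α β) {φ : Star j → P.relations j} (hφ : P.IsRelationMatrix φ)
    {ψ : Star i → P.relations i} (hψ : P.IsRelationMatrix ψ) [Subsingleton (Star i)] :
    ∃ δ : j ⟶ k, ∃ w ∈ P.rad, P.arr β * w = 0 ∧ P.idem j * w = w ∧ w * P.idem k = w ∧
      P.arrowForm δ w ≠ 0 := by
  obtain ⟨δ, s, -, hs⟩ := h.exists_relation hφ
  obtain ⟨r, rfl⟩ := hψ.exists_eq_sum s
  rw [Fintype.sum_subsingleton _ ⟨j, β⟩, map_smul, smul_eq_mul, arrowForm_mul_relCoeff] at hs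
  have hβψ := hψ.sum_arr_smul
  rw [Fintype.sum_subsingleton _ ⟨j, β⟩] at hβψ
  have relCoeff_smul := (P.relCoeff ⟨k, α⟩).map_smul
  exact ⟨δ, P.relCoeff ⟨k, α⟩ (ψ ⟨j, β⟩), P.relCoeff_mem_rad _ _,
    (relCoeff_smul _ _).symm.trans ((congrArg _ hβψ).trans (map_zero _)),
    (relCoeff_smul _ _).symm.trans (congrArg _ (hψ.idem_smul ⟨j, β⟩)),
    P.relCoeff_mul_idem _ _, right_ne_zero_of_mul hs⟩

theorem arr_mem_sup_of_costar {U : Submodule K A} {j : V}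
    (hinj : Function.Injective (Sigma.fst : Costar j → V)) {f : Costar j} {w : A} (hw : w ∈ P.rad)
    (hwU : w ∈ U) (hfw : P.idem f.1 * w = w) (hwj : w * P.idem j = w)
    (hf : P.arrowForm f.2 w ≠ 0) : P.arr f.2 ∈ U ⊔ P.rad * P.rad := by
  have hsq := P.sub_sum_costar_mem_rad_mul_rad hw hwj
  rw [Finset.sum_eq_single_of_mem f (Finset.mem_univ _) fun g _ hg => by
    rw [P.arrowForm_eq_zero_of_idem_mul g.2 hfw (hinj.ne hg.symm), zero_smul]] at hsq
  refine (Submodule.smul_mem_iff _ hf).1 ?_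
  rw [← sub_sub_cancel w (_ • _)]
  exact sub_mem (Submodule.mem_sup_left hwU) (Submodule.mem_sup_right hsq)

theorem arr_mem_sup_of_star {U : Submodule K A} {j : V}
    (hinj : Function.Injective (Sigma.fst : Star j → V)) {f : Star j} {w : A} (hw : w ∈ P.rad)
    (hwU : w ∈ U) (hjw : P.idem j * w = w) (hwf : w * P.idem f.1 = w)
    (hf : P.arrowForm f.2 w ≠ 0) : P.arr f.2 ∈ U ⊔ P.rad * P.rad := by
  have hsq := P.sub_sum_star_mem_rad_mul_rad hw hjw
  rw [Finset.sum_eq_single_of_mem f (Finset.mem_univ _) fun g _ hg => by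
    rw [P.arrowForm_eq_zero_of_mul_idem g.2 hwf (hinj.ne hg.symm), zero_smul]] at hsq
  refine (Submodule.smul_mem_iff _ hf).1 ?_
  rw [← sub_sub_cancel w (_ • _)]
  exact sub_mem (Submodule.mem_sup_left hwU) (Submodule.mem_sup_right hsq)

theorem rad_mul_eq_zero {j : V} {x : A} (hx : P.idem j * x = x)
    (hinj : Function.Injective (Sigma.fst : Costar j → V))
    (h : ∀ f : Costar j, ∃ w ∈ P.rad, w * x = 0 ∧ P.idem f.1 * w = w ∧ w * P.idem j = w ∧
      P.arrowForm f.2 w ≠ 0) {y : A} (hy : y ∈ P.rad) : y * x = 0 := by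
  let U := LinearMap.ker (LinearMap.mulRight K x)
  have harr (f : Costar j) : P.arr f.2 ∈ U ⊔ P.rad * P.rad := by
    obtain ⟨w, hw, hwx, hfw, hwj, hf⟩ := h f
    exact P.arr_mem_sup_of_costar hinj hw hwx hfw hwj hf
  refine le_of_le_sup_mul_self (U := U) P.isNilpotent_rad
    (.inl <| Submodule.mul_le.2 fun a _ u hu => ?_) (fun z hz => ?_) hy
  · change a * u * x = 0
    rw [mul_assoc, show u * x = 0 from hu, mul_zero]
  · have hzU : z - z * P.idem j ∈ U := by
      change (z - z * P.idem j) * x = 0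
      rw [sub_mul, mul_assoc, hx, sub_self]
    have hsq := P.sub_sum_costar_mem_rad_mul_rad (P.mul_mem_rad_right hz (P.idem j)) (a := j)
      (by rw [mul_assoc, P.isIdempotentElem_idem])
    have hzj : z * P.idem j ∈ U ⊔ P.rad * P.rad :=
      (Submodule.sub_mem_iff_left _ <| Submodule.sum_mem _ fun f _ =>
        Submodule.smul_mem _ _ (harr f)).1 (Submodule.mem_sup_right hsq)
    exact (Submodule.sub_mem_iff_left _ hzj).1 (Submodule.mem_sup_left hzU)

theorem mul_rad_eq_zero {j : V} {x : A} (hx : x * P.idem j = x)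
    (hinj : Function.Injective (Sigma.fst : Star j → V))
    (h : ∀ f : Star j, ∃ w ∈ P.rad, x * w = 0 ∧ P.idem j * w = w ∧ w * P.idem f.1 = w ∧
      P.arrowForm f.2 w ≠ 0) {y : A} (hy : y ∈ P.rad) : x * y = 0 := by
  let U := LinearMap.ker (LinearMap.mulLeft K x)
  have harr (f : Star j) : P.arr f.2 ∈ U ⊔ P.rad * P.rad := by
    obtain ⟨w, hw, hwx, hjw, hwf, hf⟩ := h f
    exact P.arr_mem_sup_of_star hinj hw hwx hjw hwf hf
  refine le_of_le_sup_mul_self (U := U) P.isNilpotent_rad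
    (.inr <| Submodule.mul_le.2 fun u hu a _ => ?_) (fun z hz => ?_) hy
  · change x * (u * a) = 0
    rw [← mul_assoc, show x * u = 0 from hu, zero_mul]
  · have hzU : z - P.idem j * z ∈ U := by
      change x * (z - P.idem j * z) = 0
      rw [mul_sub, ← mul_assoc, hx, sub_self]
    have hsq := P.sub_sum_star_mem_rad_mul_rad (P.mul_mem_rad_left (P.idem j) hz) (a := j)
      (by rw [← mul_assoc, P.isIdempotentElem_idem])
    have hzj : P.idem j * z ∈ U ⊔ P.rad * P.rad :=
      (Submodule.sub_mem_iff_left _ <| Submodule.sum_mem _ fun f _ =>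
        Submodule.smul_mem _ _ (harr f)).1 (Submodule.mem_sup_right hsq)
    exact (Submodule.sub_mem_iff_left _ hzj).1 (Submodule.mem_sup_left hzU)

variable {A : Type (max u v w)} [Ring A] [Algebra K A] (P : AdmissiblePresentation K V A)

theorem not_occurs_and_occurs_of_costar (hsymm : IsSymmAlgebra K A)
    (hper : IsIteratedSyzygy 4 (regularBimodule K A) (regularBimodule K A)) {i j k l : V}
    [Subsingleton (Costar i)] (hj : Nat.card (Costar j) ≤ 2) (α : j ⟶ i) {β : i ⟶ k} {β' : i ⟶ l}
    (hkl : k ≠ l) : ¬ (P.Occurs α β ∧ P.Occurs α β') := by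
  rintro ⟨h, h'⟩
  obtain ⟨φ, hφ⟩ := P.exists_isRelationMatrix hsymm hper k
  obtain ⟨φ', hφ'⟩ := P.exists_isRelationMatrix hsymm hper l
  obtain ⟨δ, hδ⟩ := h.exists_mul_arr_eq_zero hφ
  obtain ⟨δ', hδ'⟩ := h'.exists_mul_arr_eq_zero hφ'
  have hcases := eq_or_eq_of_card_le_two hj (x := ⟨k, δ⟩) (y := ⟨l, δ'⟩)
    fun h => hkl (congrArg Sigma.fst h)
  have hji : j ≠ i := by
    rintro rfl
    exact hkl (congrArg Sigma.fst (Subsingleton.elim (⟨k, δ⟩ : Costar j) ⟨l, δ'⟩))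
  have hinj : Function.Injective (Sigma.fst : Costar j → V) := by
    intro f g
    obtain rfl | rfl := hcases f <;> obtain rfl | rfl := hcases g <;> simp [hkl, hkl.symm]
  refine P.not_rad_annihilates_arr hsymm α hji <| .inr fun y =>
    P.rad_mul_eq_zero (P.idem_mul_arr α) hinj fun f => ?_
  obtain rfl | rfl := hcases f
  exacts [hδ, hδ']

theorem not_occurs_and_occurs_of_star (hsymm : IsSymmAlgebra K A)
    (hper : IsIteratedSyzygy 4 (regularBimodule K A) (regularBimodule K A)) {i j k l : V}
    [Subsingleton (Star i)] (hj : Nat.card (Star j) ≤ 2) {α : k ⟶ i} {α' : l ⟶ i} (β : i ⟶ j)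
    (hkl : k ≠ l) : ¬ (P.Occurs α β ∧ P.Occurs α' β) := by
  rintro ⟨h, h'⟩
  obtain ⟨φ, hφ⟩ := P.exists_isRelationMatrix hsymm hper j
  obtain ⟨ψ, hψ⟩ := P.exists_isRelationMatrix hsymm hper i
  obtain ⟨δ, hδ⟩ := h.exists_arr_mul_eq_zero hφ hψ
  obtain ⟨δ', hδ'⟩ := h'.exists_arr_mul_eq_zero hφ hψ
  have hcases := eq_or_eq_of_card_le_two hj (x := ⟨k, δ⟩) (y := ⟨l, δ'⟩)
    fun h => hkl (congrArg Sigma.fst h)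
  have hij : i ≠ j := by
    rintro rfl
    exact hkl (congrArg Sigma.fst (Subsingleton.elim (⟨k, δ⟩ : Star i) ⟨l, δ'⟩))
  have hinj : Function.Injective (Sigma.fst : Star j → V) := by
    intro f g
    obtain rfl | rfl := hcases f <;> obtain rfl | rfl := hcases g <;> simp [hkl, hkl.symm]
  refine P.not_rad_annihilates_arr hsymm β hij <| .inl fun y =>
    P.mul_rad_eq_zero (P.arr_mul_idem β) hinj fun f => ?_
  obtain rfl | rfl := hcases f
  exacts [hδ, hδ']

end AdmissiblePresentation

theorem PathAlgebra.OccursIn.occurs {K : Type u} {V : Type v} [Field K] [Fintype V]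
    [Quiver.{w} V] [∀ a b : V, Finite (a ⟶ b)] {I : Ideal (PathAlgebra K V)} [I.IsTwoSided]
    {a b c : V} {α : a ⟶ b} {β : b ⟶ c} (h : OccursIn (α.toPath.comp β.toPath) I)
    (hI : IsAdmissible I) : hI.presentation.Occurs α β := by
  classical
  obtain ⟨ρ, ⟨hρ, -, -⟩, hc⟩ := h
  let P := hI.presentation
  have hρ0 : P.hom ρ = 0 := Ideal.Quotient.eq_zero_iff_mem.2 hρ
  have hρR : ρ ∈ arrowIdeal K V :=
    mem_arrowIdeal_iff.2 fun d => vertexCoeff_of_mem_arrowIdeal_sq d (P.ker_le_sq hρ0)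
  obtain ⟨q, hq⟩ := exists_mul_vertexIdem_eq_sum hρR c
  have hqβ : arrowCoeff K α (q ⟨b, β⟩) = coeffHom K ⟨a, c, α.toPath.comp β.toPath⟩ ρ := by
    have hcoeff := congrArg (coeffHom K ⟨a, c, α.toPath.cons β⟩) hq
    rw [coeffHom_mul_vertexIdem, if_pos rfl, map_sum, Finset.sum_eq_single_of_mem ⟨b, β⟩
      (Finset.mem_univ _) fun f _ hf => ?_, coeffHom_cons_mul_arrow, if_pos rfl] at hcoeff
    · exact hcoeff.symm
    · rw [coeffHom_cons_mul_arrow, if_neg]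
      intro h
      cases h
      exact hf rfl
  obtain ⟨x, hx⟩ := P.exists_relCoeff_eq (q := fun f => P.hom (q f) * P.idem f.1)
    (fun f => by rw [mul_assoc, P.isIdempotentElem_idem]) <| by
      simp only [mul_assoc, P.idem_mul_arr]
      simpa only [map_mul, map_sum, hρ0, zero_mul] using! (congrArg P.hom hq).symm
  refine ⟨x, ?_⟩
  rw [hx, P.arrowForm_mul, P.vertexChar_idem_self, P.arrowForm_idem, P.arrowForm_hom, hqβ,
    mul_zero, zero_add, mul_one]
  exact hc

end

theorem lemma5p2_general {K : Type u} [Field K] {V : Type v} [Fintype V] [Quiver.{w} V]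
    [∀ a b : V, Finite (a ⟶ b)] (hbis : Quiver.IsBiserial V)
    (I : Ideal (PathAlgebra K V)) [I.IsTwoSided] (hadm : PathAlgebra.IsAdmissible I)
    (hsymm : IsSymmAlgebra K (PathAlgebra K V ⧸ I))
    (hper : IsIteratedSyzygy 4 (regularBimodule K (PathAlgebra K V ⧸ I))
      (regularBimodule K (PathAlgebra K V ⧸ I))) :
    ¬ ∃ i : V, Quiver.IsProperVertex i ∧ Quiver.IsTypeR I i := by
  rintro ⟨i, hprop, -, hR⟩
  rcases hprop with ⟨⟨hin, hout⟩, hp⟩ | ⟨⟨hin, hout⟩, hp⟩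
  · obtain ⟨_, ⟨α⟩⟩ := Nat.card_eq_one_iff_unique.1 hin
    obtain ⟨β, β', hne, -⟩ := Nat.card_eq_two_iff.1 hout
    exact hadm.presentation.not_occurs_and_occurs_of_costar hsymm hper (hbis α.1).2 α.2
      (hp β β' hne) ⟨(hR α β).occurs hadm, (hR α β').occurs hadm⟩
  · obtain ⟨α, α', hne, -⟩ := Nat.card_eq_two_iff.1 hin
    obtain ⟨_, ⟨β⟩⟩ := Nat.card_eq_one_iff_unique.1 hout
    exact hadm.presentation.not_occurs_and_occurs_of_star hsymm hper (hbis β.1).1 β.2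
      (hp α α' hne) ⟨(hR α β).occurs hadm, (hR α' β).occurs hadm⟩

theorem lemma5p2 {K : Type u} [Field K] [IsAlgClosed K]
    {V : Type v} [Fintype V] [Quiver.{w} V] [∀ a b : V, Finite (a ⟶ b)]
    (hconn : Quiver.IsConnectedQuiver V) (hbis : Quiver.IsBiserial V)
    (I : Ideal (PathAlgebra K V)) [I.IsTwoSided] (hadm : PathAlgebra.IsAdmissible I)
    (htame : IsTameAlgebra K (PathAlgebra K V ⧸ I))
    (hsymm : IsSymmAlgebra K (PathAlgebra K V ⧸ I))
    (hper : IsPeriodicAlgebra K (PathAlgebra K V ⧸ I) 4) :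
    ¬ ∃ i : V, ¬ Quiver.IsRegularVertex i ∧ Quiver.IsProperVertex i ∧ Quiver.IsTypeR I i :=
  fun ⟨i, _, hprop, hR⟩ => lemma5p2_general hbis I hadm hsymm hper.1.2 ⟨i, hprop, hR⟩
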